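/- Let $d\ge 2$ and let $j:(0,\infty)\to(0,\infty)$ be non-increasing with $\int_{\mathbb R^d}(1\wedge|x|^2)\,j(|x|)\,dx<\infty$; put $k(x,y)=j(|x-y|)$. Let $D\subset\mathbb R^d$ be a non-empty bounded open set whose boundary has Lebesgue measure zero, and write $D^c=\mathbb R^d\setminus D$. For $x\in D^c$ let $\mu(x)=\int_D k(x,y)\,dy\in[0,\infty]$, and let $$m(dx)=\mathbf 1_D(x)\,dx+\mathbf 1_{D^c}(x)\,\mu(x)\,dx ,$$ $$\widehat{\mathcal E}(u,v)=\frac12\iint_{(\mathbb R^d\times\mathbb R^d)\setminus(D^c\times D^c)}(u(x)-u(y))(v(x)-v(y))\,k(x,y)\,dy\,dx ,$$ $$\mathcal F=\{u\in L^2(\mathbb R^d,m):\ \widehat{\mathcal E}(u,u)<\infty\},\qquad \widehat{\mathcal E}_1(u,v)=\widehat{\mathcal E}(u,v)+\langle u,v\rangle_{L^2(\mathbb R^d,m)} .$$ An $\widehat{\mathcal E}$-nest is an increasing sequence $(F_n)$ of closed sets such that $\bigcup_n\{u\in\mathcal F: u=0\ m\text{-a.e. on }\mathbb R^d\setminus F_n\}$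 is $\widehat{\mathcal E}_1$-dense in $\mathcal F$; a set is $\widehat{\mathcal E}$-polar if it is contained in $\bigcap_n(\mathbb R^d\setminus F_n)$ for some $\widehat{\mathcal E}$-nest; a function $f:\mathbb R^d\to\mathbb R$ is $\widehat{\mathcal E}$-quasi-continuous if for some $\widehat{\mathcal E}$-nest $(F_n)$ every restriction $f|_{F_n}$ is continuous. **Theorem.** The form $(\widehat{\mathcal E},\mathcal F)$ is a quasi-regular Dirichlet form on $L^2(\mathbb R^d,m)$. That is, $m$ is $\sigma$-finite with full support; $\widehat{\mathcal E}$ is a nonnegative symmetric bilinear form on $\mathcal F$; $\mathcal F$ is a linear subspace that is dense in $L^2(\mathbb R^d,m)$ and complete for the norm $\widehat{\mathcal E}_1(u,u)^{1/2}$; for every $u\in\mathcal F$ the function $v=(0\vee u)\wedge 1$ lies in $\mathcal F$ and $\widehat{\mathcal E}(v,v)\le\widehat{\mathcal E}(u,u)$; and 1. there is an $\widehat{\mathcal E}$-nest of compact sets; 2. there is an $\widehat{\mathcal E}_1$-dense subset of $\mathcal F$ each of whose elements has an $\widehat{\mathcal E}$-quasi-continuous $m$-version; 3. there are countably many $u_n\in\mathcal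 F$ with $\widehat{\mathcal E}$-quasi-continuous $m$-versions $\tilde u_n$, and an $\widehat{\mathcal E}$-polar set $N$, such that $(\tilde u_n)$ separates the points of $\mathbb R^d\setminus N$. -/

import Mathlib

open MeasureTheory Filter Topology
open scoped ENNReal

noncomputable section

/-! ### Symmetric Dirichlet forms on `L²(X, m)`

A form is given by its domain `dom`, a set of elements of `L²(X, m)`, and a function `E` of two
elements of `L²(X, m)` of which only the values on `dom` matter. -/

namespace DirichletForm

variable {X : Type*} [MeasurableSpace X] {m : Measure X}

/-- `E₁(u, v) = E(u, v) + ⟨u, v⟩_{L²(m)}`. -/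
def formOne (E : Lp ℝ 2 m → Lp ℝ 2 m → ℝ) (u v : Lp ℝ 2 m) : ℝ :=
  E u v + inner ℝ u v

/-- `(E, dom)` is a (symmetric) Dirichlet form on `L²(X, m)`: a densely defined, nonnegative,
symmetric bilinear form that is closed and on which the unit contraction operates. -/
structure IsDirichletForm (dom : Set (Lp ℝ 2 m)) (E : Lp ℝ 2 m → Lp ℝ 2 m → ℝ) : Prop where
  zero_mem : (0 : Lp ℝ 2 m) ∈ dom
  add_mem : ∀ u ∈ dom, ∀ v ∈ dom, u + v ∈ dom
  smul_mem : ∀ (c : ℝ), ∀ u ∈ dom, c • u ∈ dom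
  dense : Dense dom
  symm : ∀ u ∈ dom, ∀ v ∈ dom, E u v = E v u
  add_left : ∀ u ∈ dom, ∀ v ∈ dom, ∀ w ∈ dom, E (u + v) w = E u w + E v w
  smul_left : ∀ (c : ℝ), ∀ u ∈ dom, ∀ v ∈ dom, E (c • u) v = c * E u v
  nonneg : ∀ u ∈ dom, 0 ≤ E u u
  /-- `dom` is complete with respect to the norm `E₁(u, u)^{1/2}`. -/
  closed : ∀ u : ℕ → Lp ℝ 2 m, (∀ n, u n ∈ dom) →
    (∀ ε > 0, ∃ N, ∀ n ≥ N, ∀ l ≥ N, formOne E (u n - u l) (u n - u l) < ε) →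
    ∃ v ∈ dom, Tendsto (fun n => formOne E (u n - v) (u n - v)) atTop (𝓝 0)
  /-- If `u ∈ dom` and `v = (0 ∨ u) ∧ 1`, then `v ∈ dom` and `E(v, v) ≤ E(u, u)`. -/
  markov : ∀ u ∈ dom, ∀ v : Lp ℝ 2 m, (v =ᵐ[m] fun x => min (max (u x) 0) 1) →
    v ∈ dom ∧ E v v ≤ E u u

/-- `S` is an `E₁`-dense subset of the domain. -/
def IsFormDense (dom : Set (Lp ℝ 2 m)) (E : Lp ℝ 2 m → Lp ℝ 2 m → ℝ)
    (S : Set (Lp ℝ 2 m)) : Prop :=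
  S ⊆ dom ∧ ∀ u ∈ dom, ∀ ε > 0, ∃ v ∈ S, formOne E (u - v) (u - v) < ε

/-- The set of `u ∈ dom` with `u = 0` `m`-a.e. on the complement of `A`. -/
def domOn (dom : Set (Lp ℝ 2 m)) (A : Set X) : Set (Lp ℝ 2 m) :=
  {u | u ∈ dom ∧ ∀ᵐ x ∂m, x ∉ A → u x = 0}

variable [TopologicalSpace X]

/-- `(A k)` is an `E`-nest: an increasing sequence of closed sets such that the union of the
spaces `domOn dom (A k)` is `E₁`-dense in `dom`. -/
structure IsNest (dom : Set (Lp ℝ 2 m)) (E : Lp ℝ 2 m → Lp ℝ 2 m → ℝ)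
    (A : ℕ → Set X) : Prop where
  isClosed : ∀ k, IsClosed (A k)
  mono : Monotone A
  dense : IsFormDense dom E (⋃ k, domOn dom (A k))

/-- `N` is `E`-polar: it is contained in the intersection of the complements of the members of
some `E`-nest. -/
def IsPolar (dom : Set (Lp ℝ 2 m)) (E : Lp ℝ 2 m → Lp ℝ 2 m → ℝ) (N : Set X) : Prop :=
  ∃ A : ℕ → Set X, IsNest dom E A ∧ N ⊆ ⋂ k, (A k)ᶜ

/-- `f` is `E`-quasi-continuous: its restriction to each member of some `E`-nest is
continuous. -/
def IsQuasiContinuous (dom : Set (Lp ℝ 2 m)) (E : Lp ℝ 2 m → Lp ℝ 2 m → ℝ)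
    (f : X → ℝ) : Prop :=
  ∃ A : ℕ → Set X, IsNest dom E A ∧ ∀ k, ContinuousOn f (A k)

/-- `f` is an `E`-quasi-continuous `m`-version of `u`. -/
def IsQuasiContinuousVersion (dom : Set (Lp ℝ 2 m)) (E : Lp ℝ 2 m → Lp ℝ 2 m → ℝ)
    (u : Lp ℝ 2 m) (f : X → ℝ) : Prop :=
  u =ᵐ[m] f ∧ IsQuasiContinuous dom E f

/-- `(E, dom)` is a quasi-regular Dirichlet form on `L²(X, m)`. The usual standing assumptions
on `m` (σ-finite with full topological support) are part of the notion. -/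
structure IsQuasiRegularDirichletForm (dom : Set (Lp ℝ 2 m))
    (E : Lp ℝ 2 m → Lp ℝ 2 m → ℝ) : Prop where
  sigmaFinite : SigmaFinite m
  fullSupport : m.IsOpenPosMeasure
  isDirichletForm : IsDirichletForm dom E
  exists_compact_nest : ∃ A : ℕ → Set X, IsNest dom E A ∧ ∀ k, IsCompact (A k)
  exists_dense_quasiContinuous : ∃ S : Set (Lp ℝ 2 m), IsFormDense dom E S ∧
    ∀ u ∈ S, ∃ f : X → ℝ, IsQuasiContinuousVersion dom E u f
  exists_separating : ∃ (u : ℕ → Lp ℝ 2 m) (f : ℕ → X → ℝ) (N : Set X),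
    (∀ n, u n ∈ dom ∧ IsQuasiContinuousVersion dom E (u n) (f n)) ∧ IsPolar dom E N ∧
    ∀ x ∉ N, ∀ y ∉ N, x ≠ y → ∃ n, f n x ≠ f n y

end DirichletForm

/-! ### The non-local form -/

namespace NonlocalForm

variable {d : ℕ}

/-- The kernel `k(x, y) = j(|x - y|)`. -/
def kernel (j : ℝ → ℝ) (x y : EuclideanSpace ℝ (Fin d)) : ℝ := j ‖x - y‖

/-- `μ(x) = ∫_D k(x, y) dy`, as an element of `[0, ∞]` (the value may be `∞` on `∂D`). -/
def mu (j : ℝ → ℝ) (D : Set (EuclideanSpace ℝ (Fin d))) (x : EuclideanSpace ℝ (Fin d)) : ℝ≥0∞ :=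
  ∫⁻ y in D, ENNReal.ofReal (kernel j x y)

/-- The measure `m(dx) = 1_D(x) dx + 1_{Dᶜ}(x) μ(x) dx`. -/
def refMeasure (j : ℝ → ℝ) (D : Set (EuclideanSpace ℝ (Fin d))) :
    Measure (EuclideanSpace ℝ (Fin d)) :=
  volume.restrict D + (volume.restrict Dᶜ).withDensity (mu j D)

/-- `Ê(u, u)` as an element of `[0, ∞]`. -/
def energy (j : ℝ → ℝ) (D : Set (EuclideanSpace ℝ (Fin d)))
    (u : EuclideanSpace ℝ (Fin d) → ℝ) : ℝ≥0∞ :=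
  2⁻¹ * ∫⁻ p in (Dᶜ ×ˢ Dᶜ)ᶜ, ENNReal.ofReal ((u p.1 - u p.2) ^ 2 * kernel j p.1 p.2)
    ∂((volume : Measure (EuclideanSpace ℝ (Fin d))).prod volume)

/-- `Ê(u, v)`, the integral being taken over `(ℝᵈ × ℝᵈ) \ (Dᶜ × Dᶜ)`. -/
def form (j : ℝ → ℝ) (D : Set (EuclideanSpace ℝ (Fin d)))
    (u v : EuclideanSpace ℝ (Fin d) → ℝ) : ℝ :=
  2⁻¹ * ∫ p in (Dᶜ ×ˢ Dᶜ)ᶜ, (u p.1 - u p.2) * (v p.1 - v p.2) * kernel j p.1 p.2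
    ∂((volume : Measure (EuclideanSpace ℝ (Fin d))).prod volume)

/-- `F = {u ∈ L²(ℝᵈ, m) : Ê(u, u) < ∞}`. -/
def formDomain (j : ℝ → ℝ) (D : Set (EuclideanSpace ℝ (Fin d))) :
    Set (Lp ℝ 2 (refMeasure j D)) :=
  {u | energy j D u < ∞}

/-- `Ê` as a function of two elements of `L²(ℝᵈ, m)`. -/
def formLp (j : ℝ → ℝ) (D : Set (EuclideanSpace ℝ (Fin d)))
    (u v : Lp ℝ 2 (refMeasure j D)) : ℝ :=
  form j D u v

end NonlocalForm

end

/-! The weight `μ` is chosen so that the part of a function outside `D` costs no more energy than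
its `L²(m)` norm. If `h` vanishes on `D`, only jumps between `D` and `Dᶜ` contribute to the energy
of `h`, and integrating out the endpoint in `D` turns `k` into `μ`; hence the energy of `h` is at
most a constant times `∫ h² dm` (`sqInt_diff_le_of_zero_on`). Therefore `u = 1_D u + 1_{Dᶜ} u`
splits the domain into two independent problems.

Outside `D` the problem is pure `L²` theory. The compact sets `outerSet D k` exhaust the complement
of `closure D`, the boundary is null, and truncation to these sets and approximation by continuous
functions need only be checked in `L²(m)`.

Inside, `1_D u` vanishes off `D`, so its norm is that of the translation invariant form with kernel
`k` on the whole space (`normOne_eq_of_zero_off`). There mollification gives continuous approximants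
(`exists_continuous_normOne_sub_lt`). Fast approximation then yields versions that are continuous on
closed sets `B k`, with cut-off functions `e k` equal to `1` off `B k` and of vanishing energy
(`Compat.exists_versions`). The mollified functions need not vanish off `D`; the functions `(1 - e
k) * innerClamp n u` that prove the nest property do.

The sets `(B k ∩ closure D) ∪ outerSet D k` form a compact nest (`isNest_glue`). Both pieces are
closed and they are disjoint, so quasi-continuous functions may be prescribed on each separately,
with no matching at the boundary. For the separation of points the inner nest is shrunk so that on
it some member of a countable dense family is nonzero (`isInnerNest_nonvanishing`). Products of
these members with truncated coordinates then separate the points of `closure D` from one another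
and from the exterior.

Closedness is the completeness of the graph of `u ↦ (diff u, u)` in `L²(ν) × L²(m)`, and density
follows by testing an orthogonal element against functions supported outside `D` and against smooth
functions with compact support in `D`. -/

noncomputable section

/-! ### Symmetric forms of pure jump type -/

namespace JumpForm

open DirichletForm

/-! ### Square integrals with values in `[0, ∞]`. -/

section SquareIntegral

variable {Y : Type*} [MeasurableSpace Y] {μ : Measure Y}

/-- `∫ f² dμ` as an element of `[0, ∞]`. -/
def sqInt (μ : Measure Y) (f : Y → ℝ) : ℝ≥0∞ := ∫⁻ x, ENNReal.ofReal (f x ^ 2) ∂μ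

theorem sqInt_eq_eLpNorm_sq (f : Y → ℝ) : sqInt μ f = eLpNorm f 2 μ ^ 2 := by
  rw [eLpNorm_eq_lintegral_rpow_enorm_toReal two_ne_zero ENNReal.ofNat_ne_top, ← ENNReal.rpow_two,
    ← ENNReal.rpow_mul]
  simp only [ENNReal.toReal_ofNat, one_div, isUnit_iff_ne_zero, ne_eq, OfNat.ofNat_ne_zero,
    not_false_eq_true, IsUnit.inv_mul_cancel, ENNReal.rpow_one, sqInt]
  refine lintegral_congr fun x => ?_
  rw [← sq_abs, ENNReal.ofReal_pow (abs_nonneg _), ← Real.norm_eq_abs, ofReal_norm,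
    ENNReal.rpow_two]

theorem memLp_two_iff_sqInt_lt_top {f : Y → ℝ} (hf : AEStronglyMeasurable f μ) :
    MemLp f 2 μ ↔ sqInt μ f < ∞ := by
  rw [sqInt_eq_eLpNorm_sq, MemLp, ENNReal.pow_lt_top_iff]
  simp [hf]

theorem norm_sq_eq_sqInt (u : Lp ℝ 2 μ) : ‖u‖ ^ 2 = (sqInt μ u).toReal := by
  rw [Lp.norm_def, sqInt_eq_eLpNorm_sq, ENNReal.toReal_pow]

theorem sqInt_coe_lt_top (u : Lp ℝ 2 μ) : sqInt μ u < ∞ :=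
  (memLp_two_iff_sqInt_lt_top (Lp.aestronglyMeasurable u)).1 (Lp.memLp u)

theorem sqInt_congr {f g : Y → ℝ} (h : f =ᵐ[μ] g) : sqInt μ f = sqInt μ g :=
  lintegral_congr_ae (h.mono fun x hx => by simp only [hx])

theorem sqInt_mono_abs {f g : Y → ℝ} (h : ∀ᵐ x ∂μ, |f x| ≤ |g x|) : sqInt μ f ≤ sqInt μ g :=
  lintegral_mono_ae (h.mono fun _ hx => ENNReal.ofReal_le_ofReal (sq_le_sq.2 hx))

theorem sqInt_add_le {f g : Y → ℝ} (hf : AEStronglyMeasurable f μ) :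
    sqInt μ (fun x => f x + g x) ≤ 2 * (sqInt μ f + sqInt μ g) := by
  unfold sqInt
  rw [← lintegral_add_left' (by fun_prop)]
  rw [← lintegral_const_mul' _ _ (by simp)]
  refine lintegral_mono fun x => ?_
  rw [← ENNReal.ofReal_add (sq_nonneg _) (sq_nonneg _), ← ENNReal.ofReal_ofNat 2,
    ← ENNReal.ofReal_mul (by norm_num)]
  exact ENNReal.ofReal_le_ofReal (by nlinarith [sq_nonneg (f x - g x)])

theorem sqInt_tendsto_zero {f : ℕ → Y → ℝ} {g : Y → ℝ} (hf : ∀ n, AEStronglyMeasurable (f n) μ)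
    (hg : sqInt μ g < ∞) (hfg : ∀ n, ∀ᵐ x ∂μ, |f n x| ≤ |g x|)
    (h : ∀ᵐ x ∂μ, Tendsto (fun n => f n x) atTop (𝓝 0)) :
    Tendsto (fun n => sqInt μ (f n)) atTop (𝓝 0) := by
  have : (0 : ℝ≥0∞) = ∫⁻ _, 0 ∂μ := by simp
  rw [this]
  refine tendsto_lintegral_of_dominated_convergence' (fun x => ENNReal.ofReal (g x ^ 2))
    (fun n => by have := hf n; fun_prop) (fun n => (hfg n).mono fun _ hx =>
      ENNReal.ofReal_le_ofReal (sq_le_sq.2 hx)) hg.ne (h.mono fun x hx => ?_)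
  have := ENNReal.tendsto_ofReal (hx.pow 2)
  simpa using this

end SquareIntegral

/-! ### Abstract jump forms: domain, closedness, Markov property, criteria for density and nests. -/

variable {X : Type*} [MeasurableSpace X] {m : Measure X} {ν : Measure (X × X)}

/-- The difference function `(x, y) ↦ u x - u y`. -/
def diff (u : X → ℝ) : X × X → ℝ := fun p => u p.1 - u p.2

/-- Both coordinate projections pull back `m`-null sets to `ν`-null sets. -/
structure Compat (m : Measure X) (ν : Measure (X × X)) : Prop where
  fst : Measure.QuasiMeasurePreserving Prod.fst ν m
  snd : Measure.QuasiMeasurePreserving Prod.snd ν m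

/-- The elements of `L²(m)` with `∬ (u x - u y)² dν < ∞`. -/
def jumpDomain (m : Measure X) (ν : Measure (X × X)) : Set (Lp ℝ 2 m) :=
  {u | sqInt ν (diff u) < ∞}

/-- The form `½ ∬ (u x - u y) (v x - v y) dν`. -/
def jumpForm (m : Measure X) (ν : Measure (X × X)) (u v : Lp ℝ 2 m) : ℝ :=
  2⁻¹ * ∫ p, diff u p * diff v p ∂ν

/-- `∬ (u x - u y)² dν + ∫ u² dm` as an element of `[0, ∞]`. -/
def normOne (m : Measure X) (ν : Measure (X × X)) (u : X → ℝ) : ℝ≥0∞ :=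
  sqInt ν (diff u) + sqInt m u

theorem Compat.diff_congr (h : Compat m ν) {u v : X → ℝ} (huv : u =ᵐ[m] v) :
    diff u =ᵐ[ν] diff v := by
  filter_upwards [h.fst.ae huv, h.snd.ae huv] with p h1 h2
  simp only [diff, h1, h2]

theorem Compat.aestronglyMeasurable_diff (h : Compat m ν) {u : X → ℝ}
    (hu : AEStronglyMeasurable u m) : AEStronglyMeasurable (diff u) ν :=
  (hu.comp_quasiMeasurePreserving h.fst).sub (hu.comp_quasiMeasurePreserving h.snd)

theorem Compat.normOne_congr (h : Compat m ν) {u v : X → ℝ} (huv : u =ᵐ[m] v) :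
    normOne m ν u = normOne m ν v := by
  rw [normOne, normOne, sqInt_congr (h.diff_congr huv), sqInt_congr huv]

theorem Compat.normOne_add_le (h : Compat m ν) {u v : X → ℝ} (hu : AEStronglyMeasurable u m) :
    normOne m ν (fun x => u x + v x) ≤ 2 * (normOne m ν u + normOne m ν v) := by
  have h1 : sqInt ν (diff fun x => u x + v x) ≤ 2 * (sqInt ν (diff u) + sqInt ν (diff v)) := by
    refine le_trans (le_of_eq ?_) (sqInt_add_le (h.aestronglyMeasurable_diff hu))
    congr 1
    funext p
    simp only [diff]
    ring
  have h2 : sqInt m (fun x => u x + v x) ≤ _ := sqInt_add_le hu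
  refine (add_le_add h1 h2).trans (le_of_eq ?_)
  simp only [normOne]
  ring

theorem normOne_neg (u : X → ℝ) : normOne m ν (fun x => -u x) = normOne m ν u := by
  simp only [normOne, sqInt, diff]
  congr 1
  · exact lintegral_congr fun p => by congr 1; ring
  · exact lintegral_congr fun p => by congr 1; ring

theorem normOne_sub_comm (u v : X → ℝ) :
    normOne m ν (fun x => u x - v x) = normOne m ν (fun x => v x - u x) := by
  rw [← normOne_neg]
  congr 1
  funext x
  ring

theorem Compat.normOne_sub_le (h : Compat m ν) {u v : X → ℝ} (w : X → ℝ)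
    (hu : AEStronglyMeasurable u m) (hw : AEStronglyMeasurable w m) :
    normOne m ν (fun x => u x - v x) ≤
      2 * (normOne m ν (fun x => u x - w x) + normOne m ν (fun x => w x - v x)) := by
  refine le_trans (le_of_eq ?_) (h.normOne_add_le (hu.sub hw))
  congr 1
  funext x
  simp

/-- If `u` is finite and `u - v` is finite, then so is `v`. -/
theorem Compat.normOne_lt_top_of_sub (h : Compat m ν) {u v : X → ℝ}
    (hu : AEStronglyMeasurable u m) (hu' : normOne m ν u < ∞)
    (huv : normOne m ν (fun x => u x - v x) < ∞) : normOne m ν v < ∞ := by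
  have := h.normOne_add_le (v := fun x => v x - u x) hu
  simp only [add_sub_cancel] at this
  refine this.trans_lt ?_
  rw [← normOne_sub_comm]
  exact ENNReal.mul_lt_top (by simp) (ENNReal.add_lt_top.2 ⟨hu', huv⟩)

theorem normOne_le_of_contraction {φ : ℝ → ℝ} (h0 : φ 0 = 0) (hφ : ∀ s t, |φ s - φ t| ≤ |s - t|)
    (u : X → ℝ) : normOne m ν (fun x => φ (u x)) ≤ normOne m ν u := by
  refine add_le_add (sqInt_mono_abs (ae_of_all _ fun p => hφ _ _))
    (sqInt_mono_abs (ae_of_all _ fun x => ?_))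
  simpa [h0] using hφ (u x) 0

theorem mem_jumpDomain_iff {u : Lp ℝ 2 m} : u ∈ jumpDomain m ν ↔ normOne m ν u < ∞ := by
  simp [jumpDomain, normOne, sqInt_coe_lt_top]

theorem Compat.toLp_mem_jumpDomain (h : Compat m ν) {f : X → ℝ} (hf : MemLp f 2 m)
    (hf' : normOne m ν f < ∞) : hf.toLp f ∈ jumpDomain m ν := by
  rwa [mem_jumpDomain_iff, h.normOne_congr hf.coeFn_toLp]

theorem memLp_of_normOne_lt_top {f : X → ℝ} (hf : AEStronglyMeasurable f m)
    (hf' : normOne m ν f < ∞) : MemLp f 2 m :=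
  (memLp_two_iff_sqInt_lt_top hf).2 (lt_of_le_of_lt le_add_self hf')

theorem Compat.memLp_diff (h : Compat m ν) {u : Lp ℝ 2 m} (hu : u ∈ jumpDomain m ν) :
    MemLp (diff u) 2 ν :=
  (memLp_two_iff_sqInt_lt_top (h.aestronglyMeasurable_diff (Lp.aestronglyMeasurable u))).2 hu

theorem Compat.diff_add (h : Compat m ν) (u v : Lp ℝ 2 m) :
    diff (u + v : Lp ℝ 2 m) =ᵐ[ν] diff u + diff v := by
  refine (h.diff_congr (Lp.coeFn_add u v)).trans (ae_of_all _ fun p => ?_)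
  simp only [diff, Pi.add_apply]
  ring

theorem Compat.diff_sub (h : Compat m ν) (u v : Lp ℝ 2 m) :
    diff (u - v : Lp ℝ 2 m) =ᵐ[ν] diff u - diff v := by
  refine (h.diff_congr (Lp.coeFn_sub u v)).trans (ae_of_all _ fun p => ?_)
  simp only [diff, Pi.sub_apply]
  ring

theorem Compat.diff_smul (h : Compat m ν) (c : ℝ) (u : Lp ℝ 2 m) :
    diff (c • u : Lp ℝ 2 m) =ᵐ[ν] c • diff u := by
  refine (h.diff_congr (Lp.coeFn_smul c u)).trans (ae_of_all _ fun p => ?_)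
  simp only [diff, Pi.smul_apply, smul_eq_mul]
  ring

theorem Compat.add_mem (h : Compat m ν) {u v : Lp ℝ 2 m} (hu : u ∈ jumpDomain m ν)
    (hv : v ∈ jumpDomain m ν) : u + v ∈ jumpDomain m ν := by
  have := ((h.memLp_diff hu).add (h.memLp_diff hv)).ae_eq (h.diff_add u v).symm
  exact (memLp_two_iff_sqInt_lt_top this.1).1 this

theorem Compat.smul_mem (h : Compat m ν) (c : ℝ) {u : Lp ℝ 2 m} (hu : u ∈ jumpDomain m ν) :
    c • u ∈ jumpDomain m ν := by
  have := ((h.memLp_diff hu).const_smul c).ae_eq (h.diff_smul c u).symm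
  exact (memLp_two_iff_sqInt_lt_top this.1).1 this

theorem zero_mem_jumpDomain (h : Compat m ν) : (0 : Lp ℝ 2 m) ∈ jumpDomain m ν := by
  rw [mem_jumpDomain_iff, h.normOne_congr (Lp.coeFn_zero ℝ 2 m)]
  simp [normOne, sqInt, diff]

/-- The domain as a submodule of `L²(m)`. -/
def Compat.domainSubmodule (h : Compat m ν) : Submodule ℝ (Lp ℝ 2 m) where
  carrier := jumpDomain m ν
  add_mem' := h.add_mem
  zero_mem' := zero_mem_jumpDomain h
  smul_mem' c _ hu := h.smul_mem c hu

theorem Compat.sub_mem (h : Compat m ν) {u v : Lp ℝ 2 m} (hu : u ∈ jumpDomain m ν)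
    (hv : v ∈ jumpDomain m ν) : u - v ∈ jumpDomain m ν :=
  h.domainSubmodule.sub_mem hu hv

theorem Compat.jumpForm_self (h : Compat m ν) (u : Lp ℝ 2 m) :
    jumpForm m ν u u = 2⁻¹ * (sqInt ν (diff u)).toReal := by
  have := h.aestronglyMeasurable_diff (Lp.aestronglyMeasurable u)
  rw [jumpForm, integral_eq_lintegral_of_nonneg_ae
    (ae_of_all _ fun p => mul_self_nonneg _) (this.mul this), sqInt]
  simp only [sq]

theorem Compat.formOne_self (h : Compat m ν) (u : Lp ℝ 2 m) :
    formOne (jumpForm m ν) u u = 2⁻¹ * (sqInt ν (diff u)).toReal + (sqInt m u).toReal := by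
  rw [formOne, h.jumpForm_self, real_inner_self_eq_norm_sq, norm_sq_eq_sqInt]

/-- `normOne` omits the factor `½`, so smallness in `normOne` suffices for every density claim. -/
theorem Compat.formOne_self_le (h : Compat m ν) {u : Lp ℝ 2 m} (hu : u ∈ jumpDomain m ν) :
    formOne (jumpForm m ν) u u ≤ (normOne m ν u).toReal := by
  rw [h.formOne_self, normOne, ENNReal.toReal_add hu.ne (sqInt_coe_lt_top u).ne]
  linarith [ENNReal.toReal_nonneg (a := sqInt ν (diff u))]

theorem Compat.formOne_lt (h : Compat m ν) {u : Lp ℝ 2 m} {f : X → ℝ} (huf : u =ᵐ[m] f) {ε : ℝ}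
    (hu : normOne m ν f < ENNReal.ofReal ε) : formOne (jumpForm m ν) u u < ε := by
  rw [← h.normOne_congr huf] at hu
  refine (h.formOne_self_le (mem_jumpDomain_iff.2 (hu.trans ENNReal.ofReal_lt_top))).trans_lt ?_
  rwa [← ENNReal.lt_ofReal_iff_toReal_lt (hu.trans ENNReal.ofReal_lt_top).ne]

/-- The difference function of an element of the domain, as an element of `L²(ν)`. -/
def Compat.diffLp (h : Compat m ν) {u : Lp ℝ 2 m} (hu : u ∈ jumpDomain m ν) : Lp ℝ 2 ν :=
  (h.memLp_diff hu).toLp _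

theorem Compat.norm_sq_diffLp_sub (h : Compat m ν) {u v : Lp ℝ 2 m} (hu : u ∈ jumpDomain m ν)
    (hv : v ∈ jumpDomain m ν) :
    ‖h.diffLp hu - h.diffLp hv‖ ^ 2 = (sqInt ν (diff (u - v : Lp ℝ 2 m))).toReal := by
  rw [norm_sq_eq_sqInt]
  congr 1
  refine sqInt_congr ?_
  filter_upwards [h.diff_sub u v, Lp.coeFn_sub (h.diffLp hu) (h.diffLp hv),
    (h.memLp_diff hu).coeFn_toLp, (h.memLp_diff hv).coeFn_toLp] with p h1 h2 h3 h4
  rw [h1, h2, Pi.sub_apply, Pi.sub_apply, diffLp, diffLp, h3, h4]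

theorem Compat.formOne_sub_self (h : Compat m ν) {u v : Lp ℝ 2 m} (hu : u ∈ jumpDomain m ν)
    (hv : v ∈ jumpDomain m ν) :
    formOne (jumpForm m ν) (u - v) (u - v) =
      2⁻¹ * ‖h.diffLp hu - h.diffLp hv‖ ^ 2 + ‖u - v‖ ^ 2 := by
  rw [h.formOne_self, h.norm_sq_diffLp_sub, norm_sq_eq_sqInt]

/-- The map `u ↦ (diff u, u)` into `L²(ν) × L²(m)` has closed graph: both components of a Cauchy
sequence converge, and almost everywhere convergence along a subsequence identifies the first limit
as the difference function of the second. -/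
theorem Compat.complete (h : Compat m ν) (u : ℕ → Lp ℝ 2 m) (hu : ∀ n, u n ∈ jumpDomain m ν)
    (hc : ∀ ε > 0, ∃ N, ∀ n ≥ N, ∀ l ≥ N,
      formOne (jumpForm m ν) (u n - u l) (u n - u l) < ε) :
    ∃ v ∈ jumpDomain m ν,
      Tendsto (fun n => formOne (jumpForm m ν) (u n - v) (u n - v)) atTop (𝓝 0) := by
  have hc1 : CauchySeq u := by
    rw [Metric.cauchySeq_iff]
    intro ε hε
    obtain ⟨N, hN⟩ := hc (ε ^ 2) (by positivity)
    refine ⟨N, fun n hn l hl => ?_⟩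
    have := hN n hn l hl
    rw [h.formOne_sub_self (hu n) (hu l)] at this
    rw [dist_eq_norm]
    exact lt_of_pow_lt_pow_left₀ 2 hε.le
      (by nlinarith [sq_nonneg ‖h.diffLp (hu n) - h.diffLp (hu l)‖])
  have hc2 : CauchySeq fun n => h.diffLp (hu n) := by
    rw [Metric.cauchySeq_iff]
    intro ε hε
    obtain ⟨N, hN⟩ := hc (2⁻¹ * ε ^ 2) (by positivity)
    refine ⟨N, fun n hn l hl => ?_⟩
    have := hN n hn l hl
    rw [h.formOne_sub_self (hu n) (hu l)] at this
    rw [dist_eq_norm]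
    exact lt_of_pow_lt_pow_left₀ 2 hε.le (by nlinarith [sq_nonneg ‖u n - u l‖])
  obtain ⟨v, hv⟩ := cauchySeq_tendsto_of_complete hc1
  obtain ⟨w, hw⟩ := cauchySeq_tendsto_of_complete hc2
  -- The second subsequence is extracted from the first, so that both limits hold almost everywhere
  -- along it.
  obtain ⟨s, hs, hsv⟩ := (tendstoInMeasure_of_tendsto_Lp hv).exists_seq_tendsto_ae
  obtain ⟨t, ht, htw⟩ := (tendstoInMeasure_of_tendsto_Lp
    (hw.comp hs.tendsto_atTop)).exists_seq_tendsto_ae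
  have hvw : w =ᵐ[ν] diff v := by
    have hd : ∀ᵐ p ∂ν, ∀ n, h.diffLp (hu n) p = diff (u n) p :=
      ae_all_iff.2 fun n => (h.memLp_diff (hu n)).coeFn_toLp
    filter_upwards [htw, h.fst.ae hsv, h.snd.ae hsv, hd] with p h1 h2 h3 h4
    refine tendsto_nhds_unique h1 ?_
    simp only [Function.comp_apply, h4]
    exact (h2.sub h3).comp ht.tendsto_atTop
  have hvm : v ∈ jumpDomain m ν := by
    have := (Lp.memLp w).ae_eq hvw
    exact (memLp_two_iff_sqInt_lt_top this.1).1 this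
  have hwv : h.diffLp hvm = w := by
    refine Lp.ext ?_
    exact (h.memLp_diff hvm).coeFn_toLp.trans hvw.symm
  refine ⟨v, hvm, ?_⟩
  simp only [fun n => h.formOne_sub_self (hu n) hvm, hwv]
  have h1 := (tendsto_iff_norm_sub_tendsto_zero.1 hw).pow 2
  have h2 := (tendsto_iff_norm_sub_tendsto_zero.1 hv).pow 2
  simpa using (h1.const_mul 2⁻¹).add h2

theorem abs_unitClamp_sub_le (s t : ℝ) :
    |min (max s 0) 1 - min (max t 0) 1| ≤ |s - t| := by
  refine (abs_min_sub_min_le_max _ _ _ _).trans ?_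
  simp only [sub_self, abs_zero]
  refine max_le ((abs_max_sub_max_le_max _ _ _ _).trans ?_) (abs_nonneg _)
  simp

theorem Compat.isDirichletForm (h : Compat m ν) (hd : Dense (jumpDomain m ν)) :
    IsDirichletForm (jumpDomain m ν) (jumpForm m ν) where
  zero_mem := zero_mem_jumpDomain h
  add_mem _ hu _ hv := h.add_mem hu hv
  smul_mem c _ hu := h.smul_mem c hu
  dense := hd
  symm u _ v _ := by simp only [jumpForm, mul_comm]
  add_left u hu v hv w hw := by
    simp only [jumpForm]
    have h1 : Integrable (fun p => diff u p * diff w p) ν :=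
      (h.memLp_diff hu).integrable_mul (h.memLp_diff hw)
    have h2 : Integrable (fun p => diff v p * diff w p) ν :=
      (h.memLp_diff hv).integrable_mul (h.memLp_diff hw)
    rw [← mul_add, ← integral_add h1 h2]
    congr 1
    refine integral_congr_ae ((h.diff_add u v).mono fun p hp => ?_)
    simp only [hp, Pi.add_apply]
    ring
  smul_left c u hu v hv := by
    simp only [jumpForm]
    rw [mul_left_comm c, ← integral_const_mul c]
    congr 1
    refine integral_congr_ae ((h.diff_smul c u).mono fun p hp => ?_)
    simp only [hp, Pi.smul_apply, smul_eq_mul]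
    ring
  nonneg u _ := by
    rw [h.jumpForm_self]
    positivity
  closed := h.complete
  markov u hu v hv := by
    have hle : sqInt ν (diff v) ≤ sqInt ν (diff u) := by
      rw [sqInt_congr (h.diff_congr hv)]
      exact sqInt_mono_abs (ae_of_all _ fun p => abs_unitClamp_sub_le _ _)
    refine ⟨hle.trans_lt hu, ?_⟩
    rw [h.jumpForm_self, h.jumpForm_self]
    gcongr
    exact hu.ne

/-- A criterion for form density in terms of functions. -/
theorem Compat.isFormDense (h : Compat m ν) {S : Set (Lp ℝ 2 m)} (hS : S ⊆ jumpDomain m ν)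
    (hd : ∀ u : X → ℝ, Measurable u → normOne m ν u < ∞ → ∀ ε > 0, ∃ g : X → ℝ,
      normOne m ν (fun x => u x - g x) < ε ∧ ∃ v ∈ S, v =ᵐ[m] g) :
    IsFormDense (jumpDomain m ν) (jumpForm m ν) S := by
  refine ⟨hS, fun u hu ε hε => ?_⟩
  have hum := (Lp.aestronglyMeasurable u).aemeasurable
  obtain ⟨g, hg, v, hv, hvg⟩ := hd (hum.mk u) hum.measurable_mk
    (by rw [← h.normOne_congr hum.ae_eq_mk]; exact mem_jumpDomain_iff.1 hu)
    (ENNReal.ofReal ε) (by simpa using hε)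
  refine ⟨v, hv, h.formOne_lt ?_ hg⟩
  filter_upwards [Lp.coeFn_sub u v, hum.ae_eq_mk, hvg] with x h1 h2 h3
  rw [h1, Pi.sub_apply, ← h2, h3]

theorem Compat.isNest [TopologicalSpace X] (h : Compat m ν) {A : ℕ → Set X}
    (hA : ∀ k, IsClosed (A k)) (hmono : Monotone A)
    (hd : ∀ u : X → ℝ, Measurable u → normOne m ν u < ∞ → ∀ ε > 0, ∃ k, ∃ g : X → ℝ,
      AEStronglyMeasurable g m ∧ (∀ᵐ x ∂m, x ∉ A k → g x = 0) ∧
      normOne m ν (fun x => u x - g x) < ε) :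
    IsNest (jumpDomain m ν) (jumpForm m ν) A where
  isClosed := hA
  mono := hmono
  dense := by
    refine h.isFormDense (Set.iUnion_subset fun k u hu => hu.1) fun u hu hfin ε hε => ?_
    -- The bound by `1` covers `ε = ∞`: it forces `g` to have finite norm, hence to define an
    -- element of the domain.
    obtain ⟨k, g, hgm, hg, hlt⟩ := hd u hu hfin (min ε 1) (lt_min hε one_pos)
    have hgfin : normOne m ν g < ∞ := h.normOne_lt_top_of_sub hu.aestronglyMeasurable hfin
      (hlt.trans (lt_of_le_of_lt (min_le_right _ _) ENNReal.one_lt_top))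
    have hL := memLp_of_normOne_lt_top hgm hgfin
    refine ⟨g, hlt.trans_le (min_le_left _ _), hL.toLp g, ?_, hL.coeFn_toLp⟩
    refine Set.mem_iUnion.2 ⟨k, h.toLp_mem_jumpDomain hL hgfin, ?_⟩
    filter_upwards [hL.coeFn_toLp, hg] with x h1 h2 hx
    rw [h1, h2 hx]

/-- Any family of functions of finite norm has a countable dense subfamily. -/
theorem Compat.exists_countable_dense (h : Compat m ν) [MeasurableSpace.CountablyGenerated X]
    [SigmaFinite m] [SFinite ν] {P : (X → ℝ) → Prop} (h0 : ∃ u, P u)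
    (hP : ∀ u, P u → Measurable u ∧ normOne m ν u < ∞) :
    ∃ w : ℕ → X → ℝ, (∀ i, P (w i)) ∧
      ∀ u, P u → ∀ ε > 0, ∃ i, normOne m ν (fun x => u x - w i x) < ε := by
  have : Fact ((2 : ℝ≥0∞) ≠ ∞) := ⟨by simp⟩
  let T : {u // P u} → Lp ℝ 2 ν × Lp ℝ 2 m := fun u =>
    have hL := memLp_of_normOne_lt_top (hP u u.2).1.aestronglyMeasurable (hP u u.2).2
    (h.diffLp (h.toLp_mem_jumpDomain hL (hP u u.2).2), hL.toLp _)
  obtain ⟨u₀, hu₀⟩ := h0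
  -- A subset of the separable metric space `L²(ν) × L²(m)` is separable; taking the dense sequence
  -- inside the range of `T` makes its members come from functions that satisfy `P`.
  have : Nonempty (Set.range T) := ⟨⟨T ⟨u₀, hu₀⟩, Set.mem_range_self _⟩⟩
  obtain ⟨s, hs⟩ := TopologicalSpace.exists_dense_seq (Set.range T)
  choose w hw using fun i => (s i).2
  refine ⟨fun i => w i, fun i => (w i).2, fun u hu ε hε => ?_⟩
  have hδ : ∃ δ : ℝ, 0 < δ ∧ ENNReal.ofReal (δ ^ 2) + ENNReal.ofReal (δ ^ 2) < ε := by
    have ht : Tendsto (fun δ : ℝ => ENNReal.ofReal (δ ^ 2) + ENNReal.ofReal (δ ^ 2)) (𝓝[>] 0)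
        (𝓝 0) := by
      have : Tendsto (fun δ : ℝ => ENNReal.ofReal (δ ^ 2) + ENNReal.ofReal (δ ^ 2)) (𝓝 0)
          (𝓝 (ENNReal.ofReal ((0 : ℝ) ^ 2) + ENNReal.ofReal ((0 : ℝ) ^ 2))) :=
        Continuous.tendsto ((ENNReal.continuous_ofReal.comp (continuous_pow 2)).add
          (ENNReal.continuous_ofReal.comp (continuous_pow 2))) 0
      simpa using this.mono_left nhdsWithin_le_nhds
    obtain ⟨δ, h1, h2⟩ := ((ht.eventually_lt_const hε).and self_mem_nhdsWithin).exists
    exact ⟨δ, h2, h1⟩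
  obtain ⟨δ, hδ0, hδ⟩ := hδ
  obtain ⟨i, hi⟩ := hs.exists_dist_lt (⟨T ⟨u, hu⟩, Set.mem_range_self _⟩ : Set.range T) hδ0
  refine ⟨i, lt_of_le_of_lt ?_ hδ⟩
  rw [Subtype.dist_eq, ← hw i, Prod.dist_eq, max_lt_iff, dist_eq_norm, dist_eq_norm] at hi
  have hbound : ∀ {Y : Type _} [MeasurableSpace Y] {μ : Measure Y} (a : Lp ℝ 2 μ) (f : Y → ℝ),
      a =ᵐ[μ] f → ‖a‖ < δ → sqInt μ f ≤ ENNReal.ofReal (δ ^ 2) := by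
    intro Y _ μ a f haf ha
    rw [← sqInt_congr haf]
    refine (ENNReal.le_ofReal_iff_toReal_le (sqInt_coe_lt_top a).ne (by positivity)).2 ?_
    rw [← norm_sq_eq_sqInt]
    gcongr
  have hLu := memLp_of_normOne_lt_top (hP u hu).1.aestronglyMeasurable (hP u hu).2
  have hLw := memLp_of_normOne_lt_top (hP _ (w i).2).1.aestronglyMeasurable (hP _ (w i).2).2
  refine add_le_add (hbound _ _ ?_ hi.1) (hbound _ _ ?_ hi.2)
  · have e1 := (h.memLp_diff (h.toLp_mem_jumpDomain hLu (hP u hu).2)).coeFn_toLp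
    have e2 := (h.memLp_diff (h.toLp_mem_jumpDomain hLw (hP _ (w i).2).2)).coeFn_toLp
    refine (Lp.coeFn_sub _ _).trans ?_
    filter_upwards [e1, e2, h.diff_congr hLu.coeFn_toLp, h.diff_congr hLw.coeFn_toLp]
      with p h1 h2 h3 h4
    rw [Pi.sub_apply]
    simp only [T, diffLp]
    rw [h1, h2, h3, h4]
    simp only [diff]
    ring
  · refine (Lp.coeFn_sub _ _).trans ?_
    filter_upwards [hLu.coeFn_toLp, hLw.coeFn_toLp] with x h1 h2
    rw [Pi.sub_apply]
    simp only [T]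
    rw [h1, h2]

end JumpForm

end

/-! ### The kernel, the reference measure, and the comparison of energies inside and outside `D`. -/

noncomputable section

namespace NonlocalForm

open JumpForm DirichletForm

variable {d : ℕ}

local notation:max "𝔼" n:max => EuclideanSpace ℝ (Fin n)

/-- The assumptions on the profile `j` of the kernel. -/
structure IsLevyProfile (d : ℕ) (j : ℝ → ℝ) : Prop where
  dim : 2 ≤ d
  pos : ∀ r, 0 < r → 0 < j r
  anti : AntitoneOn j (Set.Ioi 0)
  levy : ∫⁻ x : EuclideanSpace ℝ (Fin d), ENNReal.ofReal (min 1 (‖x‖ ^ 2) * j ‖x‖) < ∞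

/-- The kernel density as a function with values in `[0, ∞]`. -/
def kernelDensity (d : ℕ) (j : ℝ → ℝ)
    (p : EuclideanSpace ℝ (Fin d) × EuclideanSpace ℝ (Fin d)) : ℝ≥0∞ :=
  ENNReal.ofReal (kernel j p.1 p.2)

/-- The density `(1 ∧ |x - y|²) k(x, y)`, which is integrable in each variable. -/
def levyDensity (d : ℕ) (j : ℝ → ℝ)
    (p : EuclideanSpace ℝ (Fin d) × EuclideanSpace ℝ (Fin d)) : ℝ≥0∞ :=
  ENNReal.ofReal (min 1 (‖p.1 - p.2‖ ^ 2) * kernel j p.1 p.2)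

/-- The jump measure `k(x, y) dx dy` on the whole product space. -/
def jumpMeasure (d : ℕ) (j : ℝ → ℝ) :
    Measure (EuclideanSpace ℝ (Fin d) × EuclideanSpace ℝ (Fin d)) :=
  (volume.prod volume).withDensity (kernelDensity d j)

/-- The jump measure without the jumps inside the complement of `D`. -/
def innerJumpMeasure (j : ℝ → ℝ) (D : Set 𝔼 d) : Measure (𝔼 d × 𝔼 d) :=
  (jumpMeasure d j).restrict (Dᶜ ×ˢ Dᶜ)ᶜ

variable {j : ℝ → ℝ} {D : Set 𝔼 d}

/-- Monotonicity is known only on `(0, ∞)`. The substitution `r = exp s` gives a function monotone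
on all of `ℝ`, and the value at `0` is treated apart. -/
theorem measurable_of_antitoneOn_Ioi_comp {Y : Type*} [MeasurableSpace Y] {j : ℝ → ℝ}
    (hj : AntitoneOn j (Set.Ioi 0)) {r : Y → ℝ} (hr : Measurable r) (h0 : ∀ y, 0 ≤ r y) :
    Measurable fun y => j (r y) := by
  have hg : Antitone fun s => j (Real.exp s) := fun a b hab =>
    hj (Real.exp_pos a) (Real.exp_pos b) (Real.exp_le_exp.2 hab)
  have : (fun y => j (r y)) = fun y => if r y = 0 then j 0 else j (Real.exp (Real.log (r y))) := by
    funext y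
    split_ifs with h
    · rw [h]
    · rw [Real.exp_log (lt_of_le_of_ne (h0 y) (Ne.symm h))]
  rw [this]
  exact Measurable.ite (hr (measurableSet_singleton 0)) measurable_const
    (hg.measurable.comp (Real.measurable_log.comp hr))

namespace IsLevyProfile

theorem measurable_kernel (hj : IsLevyProfile d j) :
    Measurable fun p : 𝔼 d × 𝔼 d => kernel j p.1 p.2 :=
  measurable_of_antitoneOn_Ioi_comp hj.anti (by fun_prop) fun _ => norm_nonneg _

theorem measurable_kernelDensity (hj : IsLevyProfile d j) : Measurable (kernelDensity d j) :=
  hj.measurable_kernel.ennreal_ofReal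

theorem measurable_kernelDensity_left (hj : IsLevyProfile d j) (x : 𝔼 d) :
    Measurable fun y => kernelDensity d j (x, y) :=
  hj.measurable_kernelDensity.comp measurable_prodMk_left

theorem measurable_kernelDensity_right (hj : IsLevyProfile d j) (y : 𝔼 d) :
    Measurable fun x => kernelDensity d j (x, y) :=
  hj.measurable_kernelDensity.comp measurable_prodMk_right

theorem kernel_pos (hj : IsLevyProfile d j) {x y : 𝔼 d} (h : x ≠ y) : 0 < kernel j x y :=
  hj.pos _ (norm_pos_iff.2 (sub_ne_zero.2 h))

theorem nullSingletonClass (hj : IsLevyProfile d j) : NullSingletonClass (volume : Measure 𝔼 d) := by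
  have : Nonempty (Fin d) := ⟨⟨0, by linarith [hj.dim]⟩⟩
  infer_instance

/-- Nothing is assumed about `j 0`, which may be negative; the diagonal has to be discarded before
`ENNReal.ofReal` of the kernel can be converted back to the kernel. -/
theorem ae_ne (hj : IsLevyProfile d j) :
    ∀ᵐ p : 𝔼 d × 𝔼 d ∂(volume.prod volume), p.1 ≠ p.2 := by
  have := hj.nullSingletonClass
  have hm : MeasurableSet {p : 𝔼 d × 𝔼 d | p.1 = p.2} :=
    (isClosed_eq continuous_fst continuous_snd).measurableSet
  change (volume.prod volume) {p : 𝔼 d × 𝔼 d | ¬ p.1 ≠ p.2} = 0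
  simp only [not_not]
  rw [Measure.measure_prod_null hm]
  refine ae_of_all _ fun x => ?_
  have : Prod.mk x ⁻¹' {p : 𝔼 d × 𝔼 d | p.1 = p.2} = {x} := by
    ext y
    simp [eq_comm]
  simp [this]

theorem energy_eq (hj : IsLevyProfile d j) (hD : MeasurableSet D) (u : 𝔼 d → ℝ) :
    energy j D u = 2⁻¹ * sqInt (innerJumpMeasure j D) (diff u) := by
  rw [energy, sqInt, innerJumpMeasure, jumpMeasure,
    restrict_withDensity (hD.compl.prod hD.compl).compl,
    lintegral_withDensity_eq_lintegral_mul_non_measurable _ hj.measurable_kernelDensity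
      (ae_of_all _ fun _ => ENNReal.ofReal_lt_top)]
  congr 1
  refine lintegral_congr fun p => ?_
  rw [ENNReal.ofReal_mul (sq_nonneg _), mul_comm]
  rfl

theorem formDomain_eq (hj : IsLevyProfile d j) (hD : MeasurableSet D) :
    formDomain j D = jumpDomain (refMeasure j D) (innerJumpMeasure j D) := by
  ext u
  simp only [formDomain, jumpDomain, Set.mem_ofPred_eq, hj.energy_eq hD]
  constructor
  · intro h
    by_contra h'
    rw [not_lt, top_le_iff] at h'
    simp [h', ENNReal.mul_top] at h
  · exact fun h => ENNReal.mul_lt_top (by simp) h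

theorem formLp_eq (hj : IsLevyProfile d j) (hD : MeasurableSet D) :
    formLp j D = jumpForm (refMeasure j D) (innerJumpMeasure j D) := by
  funext u v
  rw [formLp, form, jumpForm, innerJumpMeasure, jumpMeasure,
    restrict_withDensity (hD.compl.prod hD.compl).compl,
    integral_withDensity_eq_integral_toReal_smul hj.measurable_kernelDensity
      (ae_of_all _ fun _ => ENNReal.ofReal_lt_top)]
  congr 1
  refine integral_congr_ae ((ae_restrict_of_ae hj.ae_ne).mono fun p hp => ?_)
  simp only [kernelDensity, ENNReal.toReal_ofReal (hj.kernel_pos hp).le, smul_eq_mul, diff]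
  ring

theorem measurable_mu (hj : IsLevyProfile d j) (D : Set 𝔼 d) : Measurable (mu j D) :=
  hj.measurable_kernelDensity.lintegral_prod_right'

theorem mu_pos (hj : IsLevyProfile d j) (hD : IsOpen D) (hne : D.Nonempty) (x : 𝔼 d) :
    0 < mu j D x := by
  have := hj.nullSingletonClass
  have hm : Measurable fun y : 𝔼 d => ENNReal.ofReal (kernel j x y) :=
    hj.measurable_kernelDensity_left x
  rw [mu, lintegral_pos_iff_support hm]
  have hsub : D \ {x} ⊆ Function.support (fun y : 𝔼 d => ENNReal.ofReal (kernel j x y)) ∩ D := by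
    rintro y ⟨hy, hyx⟩
    refine ⟨?_, hy⟩
    simp only [Function.mem_support, ne_eq, ENNReal.ofReal_eq_zero, not_le]
    exact hj.kernel_pos (Ne.symm hyx)
  rw [Measure.restrict_apply' hD.measurableSet]
  refine lt_of_lt_of_le ?_ (measure_mono hsub)
  rw [measure_sdiff_null (measure_singleton x)]
  exact hD.measure_pos _ hne

theorem lintegral_refMeasure (hj : IsLevyProfile d j) (f : 𝔼 d → ℝ≥0∞) (hf : Measurable f) :
    ∫⁻ x, f x ∂(refMeasure j D) = (∫⁻ x in D, f x) + ∫⁻ x in Dᶜ, mu j D x * f x := by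
  rw [refMeasure, lintegral_add_measure,
    lintegral_withDensity_eq_lintegral_mul _ (hj.measurable_mu D) hf]
  rfl

theorem refMeasure_absolutelyContinuous (j : ℝ → ℝ) (D : Set 𝔼 d) : refMeasure j D ≪ volume :=
  Measure.AbsolutelyContinuous.add_left
    (Measure.restrict_le_self.absolutelyContinuous)
    ((withDensity_absolutelyContinuous _ _).trans Measure.restrict_le_self.absolutelyContinuous)

/-- Since `k > 0` off the diagonal and `D` is open and nonempty, `μ > 0` everywhere, so the density
of `m` vanishes nowhere. -/
theorem absolutelyContinuous_refMeasure (hj : IsLevyProfile d j) (hD : IsOpen D)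
    (hne : D.Nonempty) : volume ≪ refMeasure j D := by
  have h1 : volume.restrict Dᶜ ≪ (volume.restrict Dᶜ).withDensity (mu j D) :=
    withDensity_absolutelyContinuous' (hj.measurable_mu D).aemeasurable
      (ae_of_all _ fun x => (hj.mu_pos hD hne x).ne')
  intro s hs
  rw [refMeasure, Measure.add_apply, add_eq_zero] at hs
  have h2 := h1 hs.2
  rw [Measure.restrict_apply' hD.measurableSet] at hs
  rw [Measure.restrict_apply' hD.measurableSet.compl] at h2
  rw [← measure_inter_add_sdiff s hD.measurableSet, hs.1, zero_add]
  exact h2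

theorem compat_volume (j : ℝ → ℝ) : Compat (volume : Measure 𝔼 d) (jumpMeasure d j) where
  fst := Measure.quasiMeasurePreserving_fst.mono_left (withDensity_absolutelyContinuous _ _)
  snd := Measure.quasiMeasurePreserving_snd.mono_left (withDensity_absolutelyContinuous _ _)

theorem compat (hj : IsLevyProfile d j) (hD : IsOpen D) (hne : D.Nonempty) :
    Compat (refMeasure j D) (innerJumpMeasure j D) where
  fst := (compat_volume j).fst.mono Measure.restrict_le_self.absolutelyContinuous
    (hj.absolutelyContinuous_refMeasure hD hne)
  snd := (compat_volume j).snd.mono Measure.restrict_le_self.absolutelyContinuous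
    (hj.absolutelyContinuous_refMeasure hD hne)

theorem mu_le (hj : IsLevyProfile d j) {x : 𝔼 d} {r : ℝ} (hr : 0 < r) (hx : r ≤ Metric.infDist x D)
    (hD : MeasurableSet D) : mu j D x ≤ ENNReal.ofReal (j r) * volume D := by
  rw [mu, ← setLIntegral_const]
  refine setLIntegral_mono' hD fun y hy => ENNReal.ofReal_le_ofReal ?_
  have : r ≤ ‖x - y‖ := by
    rw [← dist_eq_norm]
    exact hx.trans (Metric.infDist_le_dist_of_mem hy)
  exact hj.anti hr (lt_of_lt_of_le hr this) this

/-- At positive distance `r` from `D` one has `μ ≤ j(r) |D| < ∞`. Only on the boundary can `μ` be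
infinite, and the boundary is null. -/
theorem sigmaFinite_refMeasure (hj : IsLevyProfile d j) (hD : IsOpen D) (hne : D.Nonempty)
    (hb : Bornology.IsBounded D) (hfr : volume (frontier D) = 0) :
    SigmaFinite (refMeasure j D) := by
  have : SigmaFinite ((volume.restrict Dᶜ).withDensity (mu j D)) := by
    refine SigmaFinite.withDensity_of_ne_top ?_
    rw [ae_restrict_iff' hD.measurableSet.compl]
    have : ∀ᵐ x : 𝔼 d, x ∉ frontier D := measure_eq_zero_iff_ae_notMem.1 hfr
    filter_upwards [this] with x hx hxD
    have hxc : x ∉ closure D := fun h => hx (by rw [hD.frontier_eq]; exact ⟨h, hxD⟩)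
    have hpos : 0 < Metric.infDist x D := (Metric.infDist_pos_iff_notMem_closure hne).1 hxc
    exact ((hj.mu_le hpos le_rfl hD.measurableSet).trans_lt
      (ENNReal.mul_lt_top ENNReal.ofReal_lt_top hb.measure_lt_top)).ne
  rw [refMeasure]
  infer_instance

theorem isOpenPosMeasure_refMeasure (hj : IsLevyProfile d j) (hD : IsOpen D)
    (hne : D.Nonempty) : (refMeasure j D).IsOpenPosMeasure :=
  (hj.absolutelyContinuous_refMeasure hD hne).isOpenPosMeasure

theorem sqInt_jumpMeasure (hj : IsLevyProfile d j) (F : 𝔼 d × 𝔼 d → ℝ) :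
    sqInt (jumpMeasure d j) F =
      ∫⁻ p, kernelDensity d j p * ENNReal.ofReal (F p ^ 2) ∂(volume.prod volume) := by
  rw [sqInt, jumpMeasure,
    lintegral_withDensity_eq_lintegral_mul_non_measurable _ hj.measurable_kernelDensity
      (ae_of_all _ fun _ => ENNReal.ofReal_lt_top)]
  rfl

theorem lintegral_levyDensity_left (x : 𝔼 d) : ∫⁻ y : 𝔼 d, levyDensity d j (x, y) =
    ∫⁻ x : 𝔼 d, ENNReal.ofReal (min 1 (‖x‖ ^ 2) * j ‖x‖) :=
  lintegral_sub_left_eq_self (fun z : 𝔼 d => ENNReal.ofReal (min 1 (‖z‖ ^ 2) * j ‖z‖)) x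

theorem lintegral_levyDensity_right (y : 𝔼 d) : ∫⁻ x : 𝔼 d, levyDensity d j (x, y) =
    ∫⁻ x : 𝔼 d, ENNReal.ofReal (min 1 (‖x‖ ^ 2) * j ‖x‖) :=
  lintegral_sub_right_eq_self (fun z : 𝔼 d => ENNReal.ofReal (min 1 (‖z‖ ^ 2) * j ‖z‖)) y

theorem measurable_levyDensity (hj : IsLevyProfile d j) : Measurable (levyDensity d j) :=
  ((measurable_const.min ((measurable_fst.sub measurable_snd).norm.pow_const 2)).mul
    hj.measurable_kernel).ennreal_ofReal

theorem lintegral_weight_fst_lt_top (hj : IsLevyProfile d j) {w : 𝔼 d → ℝ≥0∞} (hw : Measurable w)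
    (hw' : ∫⁻ x, w x < ∞) :
    ∫⁻ p, w p.1 * levyDensity d j p ∂((volume : Measure (𝔼 d)).prod volume) < ∞ := by
  have hl := hj.measurable_levyDensity
  rw [lintegral_prod _ (by fun_prop)]
  have : ∀ x : 𝔼 d, ∫⁻ y : 𝔼 d, w x * levyDensity d j (x, y) =
      w x * ∫⁻ x : 𝔼 d, ENNReal.ofReal (min 1 (‖x‖ ^ 2) * j ‖x‖) := by
    intro x
    rw [lintegral_const_mul _ (by fun_prop), lintegral_levyDensity_left]
  simp only [this]
  rw [lintegral_mul_const _ hw]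
  exact ENNReal.mul_lt_top hw' hj.levy

theorem lintegral_weight_snd_lt_top (hj : IsLevyProfile d j) {w : 𝔼 d → ℝ≥0∞} (hw : Measurable w)
    (hw' : ∫⁻ x, w x < ∞) :
    ∫⁻ p, w p.2 * levyDensity d j p ∂((volume : Measure (𝔼 d)).prod volume) < ∞ := by
  have hl := hj.measurable_levyDensity
  rw [lintegral_prod_symm' _ (by fun_prop)]
  have : ∀ y : 𝔼 d, ∫⁻ x : 𝔼 d, w y * levyDensity d j (x, y) =
      w y * ∫⁻ x : 𝔼 d, ENNReal.ofReal (min 1 (‖x‖ ^ 2) * j ‖x‖) := by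
    intro y
    rw [lintegral_const_mul _ (by fun_prop), lintegral_levyDensity_right]
  simp only [this]
  rw [lintegral_mul_const _ hw]
  exact ENNReal.mul_lt_top hw' hj.levy

theorem ofReal_sq_mul_kernelDensity_le {χ : 𝔼 d → ℝ} {C : ℝ} (hC : 0 ≤ C)
    (hχ : ∀ x y, (χ x - χ y) ^ 2 ≤ C * min 1 (‖x - y‖ ^ 2)) (p : 𝔼 d × 𝔼 d) :
    ENNReal.ofReal (diff χ p ^ 2) * kernelDensity d j p ≤
      ENNReal.ofReal C * levyDensity d j p := by
  rw [kernelDensity, levyDensity, ENNReal.ofReal_mul (by positivity), ← mul_assoc, ← ENNReal.ofReal_mul hC]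
  gcongr
  exact hχ _ _

/-- A bounded Lipschitz function that vanishes off `D` has finite energy. -/
theorem sqInt_diff_lt_top_of_lipschitz (hj : IsLevyProfile d j) (hD : MeasurableSet D)
    (hb : Bornology.IsBounded D) {χ : 𝔼 d → ℝ} {C : ℝ} (hC : 0 ≤ C)
    (hχ : ∀ x y, (χ x - χ y) ^ 2 ≤ C * min 1 (‖x - y‖ ^ 2)) (h0 : ∀ x ∉ D, χ x = 0) :
    sqInt (jumpMeasure d j) (diff χ) < ∞ := by
  let w : 𝔼 d → ℝ≥0∞ := D.indicator 1
  have hw : Measurable w := measurable_one.indicator hD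
  have hw' : ∫⁻ x, w x < ∞ := by
    simp only [w, lintegral_indicator_one hD]
    exact hb.measure_lt_top
  rw [hj.sqInt_jumpMeasure]
  -- The difference vanishes unless one variable lies in `D`. That variable ranges over a set of
  -- finite volume, and the Lévy density is integrable in the other.
  have hle : ∀ p : 𝔼 d × 𝔼 d, kernelDensity d j p * ENNReal.ofReal (diff χ p ^ 2) ≤
      ENNReal.ofReal C *
        (w p.1 * levyDensity d j p +
         w p.2 * levyDensity d j p) := by
    intro p
    by_cases h1 : p.1 ∈ D
    · rw [mul_comm]
      refine (ofReal_sq_mul_kernelDensity_le hC hχ p).trans ?_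
      gcongr
      simp [w, h1]
    by_cases h2 : p.2 ∈ D
    · rw [mul_comm]
      refine (ofReal_sq_mul_kernelDensity_le hC hχ p).trans ?_
      gcongr
      simp [w, h2]
    · simp [diff, h0 _ h1, h0 _ h2]
  refine (lintegral_mono hle).trans_lt ?_
  have hl := hj.measurable_levyDensity
  have hm : Measurable fun p : 𝔼 d × 𝔼 d => w p.1 * levyDensity d j p := by fun_prop
  rw [lintegral_const_mul' _ _ ENNReal.ofReal_ne_top, lintegral_add_left hm]
  exact ENNReal.mul_lt_top ENNReal.ofReal_lt_top (ENNReal.add_lt_top.2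
    ⟨hj.lintegral_weight_fst_lt_top hw hw', hj.lintegral_weight_snd_lt_top hw hw'⟩)

/-- The product of a bounded Lipschitz function and a function of finite energy has finite
energy. -/
theorem sqInt_diff_mul_lt_top (hj : IsLevyProfile d j) {χ u : 𝔼 d → ℝ} {C M : ℝ} (hC : 0 ≤ C)
    (hu : Measurable u) (hu2 : sqInt volume u < ∞) (huE : sqInt (jumpMeasure d j) (diff u) < ∞)
    (hχm : Measurable χ)
    (hχ : ∀ x y, (χ x - χ y) ^ 2 ≤ C * min 1 (‖x - y‖ ^ 2)) (hM : ∀ x, |χ x| ≤ M) :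
    sqInt (jumpMeasure d j) (diff fun x => χ x * u x) < ∞ := by
  -- Leibniz rule for differences: the first term is controlled by the energy of `u`, the second by
  -- `∫ u²` times the Lévy integral.
  have hsplit : (diff fun x => χ x * u x) = fun p : 𝔼 d × 𝔼 d =>
      χ p.1 * diff u p + u p.2 * diff χ p := by
    funext p
    simp only [diff]
    ring
  rw [hsplit]
  have hm : Measurable fun p : 𝔼 d × 𝔼 d => χ p.1 * diff u p := by
    unfold diff
    fun_prop
  refine (sqInt_add_le hm.aestronglyMeasurable).trans_lt
    (ENNReal.mul_lt_top (by simp) (ENNReal.add_lt_top.2 ⟨?_, ?_⟩))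
  · have : sqInt (jumpMeasure d j) (fun p => χ p.1 * diff u p) ≤
        ENNReal.ofReal (M ^ 2) * sqInt (jumpMeasure d j) (diff u) := by
      rw [sqInt, sqInt, ← lintegral_const_mul' _ _ ENNReal.ofReal_ne_top]
      refine lintegral_mono fun p => ?_
      rw [← ENNReal.ofReal_mul (sq_nonneg _)]
      refine ENNReal.ofReal_le_ofReal ?_
      rw [mul_pow]
      gcongr ?_ * _
      exact sq_le_sq' (by linarith [abs_le.1 (hM p.1)]) (abs_le.1 (hM p.1)).2
    exact this.trans_lt (ENNReal.mul_lt_top ENNReal.ofReal_lt_top huE)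
  · rw [hj.sqInt_jumpMeasure]
    have hle : ∀ p : 𝔼 d × 𝔼 d, kernelDensity d j p * ENNReal.ofReal ((u p.2 * diff χ p) ^ 2) ≤
        ENNReal.ofReal C * (ENNReal.ofReal (u p.2 ^ 2) *
          levyDensity d j p) := by
      intro p
      have := ofReal_sq_mul_kernelDensity_le (j := j) hC hχ p
      rw [mul_pow, ENNReal.ofReal_mul (sq_nonneg _)]
      calc _ = ENNReal.ofReal (u p.2 ^ 2) *
            (ENNReal.ofReal (diff χ p ^ 2) * kernelDensity d j p) := by ring
        _ ≤ ENNReal.ofReal (u p.2 ^ 2) * (ENNReal.ofReal C *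
            levyDensity d j p) := by gcongr
        _ = _ := by ring
    refine (lintegral_mono hle).trans_lt ?_
    rw [lintegral_const_mul' _ _ ENNReal.ofReal_ne_top]
    exact ENNReal.mul_lt_top ENNReal.ofReal_lt_top
      (hj.lintegral_weight_snd_lt_top (by fun_prop) hu2)

/-- For functions that vanish off `D`, the two energies agree. -/
theorem sqInt_diff_inner_eq {u : 𝔼 d → ℝ} (h0 : ∀ x ∉ D, u x = 0) :
    sqInt (innerJumpMeasure j D) (diff u) = sqInt (jumpMeasure d j) (diff u) := by
  rw [sqInt, sqInt, innerJumpMeasure]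
  refine setLIntegral_eq_of_support_subset ?_
  intro p hp hp'
  refine hp ?_
  simp [diff, h0 _ hp'.1, h0 _ hp'.2]

theorem sqInt_refMeasure_eq (hj : IsLevyProfile d j) (hD : MeasurableSet D) {u : 𝔼 d → ℝ}
    (hu : Measurable u) (h0 : ∀ x ∉ D, u x = 0) :
    sqInt (refMeasure j D) u = sqInt volume u := by
  rw [sqInt, hj.lintegral_refMeasure _ (by fun_prop), sqInt]
  have h1 : ∫⁻ x in Dᶜ, mu j D x * ENNReal.ofReal (u x ^ 2) = 0 := by
    rw [← setLIntegral_congr_fun (f := fun _ => 0) hD.compl]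
    · simp
    · intro x hx
      simp [h0 x hx]
  rw [h1, add_zero]
  refine setLIntegral_eq_of_support_subset ?_
  intro x hx
  by_contra h
  exact hx (by simp [h0 x h])

theorem normOne_eq_of_zero_off (hj : IsLevyProfile d j) (hD : MeasurableSet D) {u : 𝔼 d → ℝ}
    (hu : Measurable u) (h0 : ∀ x ∉ D, u x = 0) :
    normOne (refMeasure j D) (innerJumpMeasure j D) u = normOne volume (jumpMeasure d j) u := by
  rw [normOne, normOne, sqInt_diff_inner_eq h0, hj.sqInt_refMeasure_eq hD hu h0]

/-- A function that vanishes on `D` has finite energy as soon as it is square integrable. -/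
theorem sqInt_diff_le_of_zero_on (hj : IsLevyProfile d j) (hD : MeasurableSet D) {h : 𝔼 d → ℝ}
    (hh : Measurable h) (h0 : ∀ x ∈ D, h x = 0) :
    sqInt (innerJumpMeasure j D) (diff h) ≤ 2 * sqInt (refMeasure j D) h := by
  have hk := hj.measurable_kernelDensity
  set f : 𝔼 d → ℝ≥0∞ := fun x => ENNReal.ofReal (h x ^ 2) with hf
  have hfm : Measurable f := by fun_prop
  have hmu : ∫⁻ x in Dᶜ, mu j D x * f x ≤ sqInt (refMeasure j D) h := by
    rw [sqInt, hj.lintegral_refMeasure _ (by fun_prop)]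
    exact le_add_left le_rfl
  have hsymm : ∀ p : 𝔼 d × 𝔼 d, kernelDensity d j p = kernelDensity d j (p.2, p.1) := fun p => by
    simp only [kernelDensity, kernel, norm_sub_rev]
  -- Integrating `k(x, y)` over `y ∈ D` gives exactly `μ(x)`; the set `D ×ˢ Dᶜ` contributes the same
  -- amount by symmetry of the kernel.
  have h1 : ∫⁻ p, (Dᶜ ×ˢ D).indicator (fun p => kernelDensity d j p * f p.1) p
      ∂(volume.prod volume) = ∫⁻ x in Dᶜ, mu j D x * f x := by
    rw [lintegral_indicator (hD.compl.prod hD), ← Measure.prod_restrict,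
      lintegral_prod _ (by fun_prop)]
    refine lintegral_congr fun x => ?_
    dsimp only
    rw [lintegral_mul_const _ (hj.measurable_kernelDensity_left x)]
    rfl
  have h2 : ∫⁻ p, (D ×ˢ Dᶜ).indicator (fun p => kernelDensity d j p * f p.2) p
      ∂(volume.prod volume) = ∫⁻ x in Dᶜ, mu j D x * f x := by
    rw [lintegral_indicator (hD.prod hD.compl), ← Measure.prod_restrict,
      lintegral_prod_symm' _ (by fun_prop)]
    refine lintegral_congr fun x => ?_
    dsimp only
    rw [lintegral_mul_const _ (hj.measurable_kernelDensity_right x)]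
    congr 1
    exact lintegral_congr fun y => hsymm _
  have hle : sqInt (innerJumpMeasure j D) (diff h) ≤
      ∫⁻ p, ((Dᶜ ×ˢ D).indicator (fun p => kernelDensity d j p * f p.1) p +
        (D ×ˢ Dᶜ).indicator (fun p => kernelDensity d j p * f p.2) p) ∂(volume.prod volume) := by
    rw [sqInt, innerJumpMeasure, jumpMeasure,
      restrict_withDensity (hD.compl.prod hD.compl).compl,
      lintegral_withDensity_eq_lintegral_mul_non_measurable _ hk
        (ae_of_all _ fun _ => ENNReal.ofReal_lt_top),
      ← lintegral_indicator (hD.compl.prod hD.compl).compl]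
    refine lintegral_mono fun p => ?_
    by_cases hp : p ∈ (Dᶜ ×ˢ Dᶜ)ᶜ
    swap
    · simp [Set.indicator_of_notMem hp]
    rw [Set.indicator_of_mem hp, Pi.mul_apply]
    by_cases hp1 : p.1 ∈ D <;> by_cases hp2 : p.2 ∈ D
    · simp [diff, h0 _ hp1, h0 _ hp2]
    · simp [diff, h0 _ hp1, hp1, hp2, Set.indicator, f]
    · simp [diff, h0 _ hp2, hp1, hp2, Set.indicator, f]
    · exact absurd ⟨hp1, hp2⟩ hp
  refine hle.trans ?_
  rw [lintegral_add_left ((by fun_prop : Measurable fun p : 𝔼 d × 𝔼 d =>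
    kernelDensity d j p * f p.1).indicator (hD.compl.prod hD)), h1, h2, two_mul]
  exact add_le_add hmu hmu

theorem normOne_le_of_zero_on (hj : IsLevyProfile d j) (hD : MeasurableSet D) {h : 𝔼 d → ℝ}
    (hh : Measurable h) (h0 : ∀ x ∈ D, h x = 0) :
    normOne (refMeasure j D) (innerJumpMeasure j D) h ≤ 3 * sqInt (refMeasure j D) h := by
  refine (add_le_add_left (hj.sqInt_diff_le_of_zero_on hD hh h0) _).trans (le_of_eq ?_)
  ring

end IsLevyProfile

end NonlocalForm

end

/-! ### Density of the domain in `L²(m)`. -/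

noncomputable section

namespace NonlocalForm

open JumpForm DirichletForm

variable {d : ℕ}

local notation:max "𝔼" n:max => EuclideanSpace ℝ (Fin n)

variable {j : ℝ → ℝ} {D : Set 𝔼 d}

theorem sq_sub_le_of_bounded_lipschitz {χ : 𝔼 d → ℝ} {M L : ℝ} (hM : ∀ x, |χ x| ≤ M)
    (hL : ∀ x y, |χ x - χ y| ≤ L * ‖x - y‖) (x y : 𝔼 d) :
    (χ x - χ y) ^ 2 ≤ (4 * M ^ 2 + L ^ 2) * min 1 (‖x - y‖ ^ 2) := by
  have h1 : (χ x - χ y) ^ 2 ≤ 4 * M ^ 2 := by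
    have := abs_le.1 (hM x)
    have := abs_le.1 (hM y)
    nlinarith
  have h2 : (χ x - χ y) ^ 2 ≤ L ^ 2 * ‖x - y‖ ^ 2 := by
    rw [← mul_pow, ← sq_abs]
    exact pow_le_pow_left₀ (abs_nonneg _) (hL x y) 2
  rcases le_total 1 (‖x - y‖ ^ 2) with h | h
  · rw [min_eq_left h]
    nlinarith [sq_nonneg L]
  · rw [min_eq_right h]
    nlinarith [mul_nonneg (sq_nonneg M) (sq_nonneg ‖x - y‖)]

namespace IsLevyProfile

theorem normOne_lt_top_of_contDiff (hj : IsLevyProfile d j) (hD : MeasurableSet D)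
    (hb : Bornology.IsBounded D) {φ : 𝔼 d → ℝ} (hφ : ContDiff ℝ 1 φ) (hc : HasCompactSupport φ)
    (hs : tsupport φ ⊆ D) : normOne (refMeasure j D) (innerJumpMeasure j D) φ < ∞ := by
  have h0 : ∀ x ∉ D, φ x = 0 := fun x hx => image_eq_zero_of_notMem_tsupport fun h => hx (hs h)
  rw [hj.normOne_eq_of_zero_off hD hφ.continuous.measurable h0]
  obtain ⟨M, hM⟩ := hc.exists_bound_of_continuous hφ.continuous
  obtain ⟨L, hL⟩ := hφ.lipschitzWith_of_hasCompactSupport hc one_ne_zero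
  refine ENNReal.add_lt_top.2 ⟨hj.sqInt_diff_lt_top_of_lipschitz hD hb
    (C := 4 * M ^ 2 + L ^ 2) (by positivity) (sq_sub_le_of_bounded_lipschitz hM ?_) h0, ?_⟩
  · intro x y
    simpa [dist_eq_norm] using hL.dist_le_mul x y
  · exact (memLp_two_iff_sqInt_lt_top hφ.continuous.aestronglyMeasurable).1
      (hφ.continuous.memLp_of_hasCompactSupport hc)

theorem dense_jumpDomain (hj : IsLevyProfile d j) (hD : IsOpen D) (hne : D.Nonempty)
    (hb : Bornology.IsBounded D) :
    Dense (jumpDomain (refMeasure j D) (innerJumpMeasure j D)) := by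
  set m := refMeasure j D with hm
  have hc := hj.compat hD hne
  change Dense (hc.domainSubmodule : Set (Lp ℝ 2 m))
  rw [Submodule.dense_iff_topologicalClosure_eq_top, Submodule.topologicalClosure_eq_top_iff,
    Submodule.eq_bot_iff]
  intro w hw
  rw [Submodule.mem_orthogonal] at hw
  obtain ⟨f, hfm, hwf⟩ := (Lp.aestronglyMeasurable w).aemeasurable
  have hfL : MemLp f 2 m := (Lp.memLp w).ae_eq hwf
  have hDm := hD.measurableSet
  -- The function `1_{Dᶜ} f` lies in the domain merely because it is in `L²(m)`, so `f` may be
  -- tested against its own exterior part.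
  have hout : ∀ᵐ x ∂m, x ∉ D → f x = 0 := by
    have hgL : MemLp (Dᶜ.indicator f) 2 m := hfL.indicator hDm.compl
    have hg : normOne m (innerJumpMeasure j D) (Dᶜ.indicator f) < ∞ :=
      (hj.normOne_le_of_zero_on hDm (hfm.indicator hDm.compl)
        fun x hx => by simp [hx]).trans_lt
      (ENNReal.mul_lt_top (by simp) ((memLp_two_iff_sqInt_lt_top hgL.1).1 hgL))
    have h1 := hw _ (hc.toLp_mem_jumpDomain hgL hg)
    have h2 : inner ℝ (hgL.toLp _) w = inner ℝ (hgL.toLp _) (hgL.toLp _) := by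
      rw [L2.inner_def, L2.inner_def]
      refine integral_congr_ae ?_
      filter_upwards [hgL.coeFn_toLp, hwf] with x hx1 hx2
      rw [hx1, hx2]
      by_cases hx : x ∈ D <;> simp [hx]
    rw [h2, inner_self_eq_zero] at h1
    filter_upwards [hgL.coeFn_toLp, (Lp.eq_zero_iff_ae_eq_zero).1 h1] with x hx1 hx2 hx
    rw [hx1] at hx2
    simpa [hx] using hx2
  -- Smooth functions with compact support in `D` belong to the domain, and on `D` the measure `m`
  -- is Lebesgue measure.
  have hin : ∀ᵐ x ∂(volume : Measure 𝔼 d), x ∈ D → f x = 0 := by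
    have hle : volume.restrict D ≤ m := Measure.le_add_right le_rfl
    have hfin : IsFiniteMeasure (volume.restrict D) :=
      ⟨by simpa using hb.measure_lt_top⟩
    have hfi : IntegrableOn f D volume := (hfL.mono_measure hle).integrable (by norm_num)
    refine hD.ae_eq_zero_of_integral_contDiff_smul_eq_zero hfi.locallyIntegrableOn ?_
    intro φ hφ hφc hφs
    have h0 : ∀ x ∉ D, φ x = 0 := fun x hx =>
      image_eq_zero_of_notMem_tsupport fun h => hx (hφs h)
    have hφ1 : ContDiff ℝ 1 φ := hφ.of_le (by exact_mod_cast le_top)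
    have hφn := hj.normOne_lt_top_of_contDiff hDm hb hφ1 hφc hφs
    have hφL := memLp_of_normOne_lt_top hφ.continuous.aestronglyMeasurable hφn
    have h1 := hw _ (hc.toLp_mem_jumpDomain hφL hφn)
    have h2 : inner ℝ (hφL.toLp _) w = ∫ x, φ x * f x ∂m := by
      rw [L2.inner_def]
      refine integral_congr_ae ?_
      filter_upwards [hφL.coeFn_toLp, hwf] with x hx1 hx2
      rw [hx1, hx2]
      simp [mul_comm]
    have hφf : Integrable (fun x => φ x * f x) m := hφL.integrable_mul hfL
    rw [h2, hm, refMeasure, integral_add_measure] at h1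
    · have h3 : ∫ x, φ x * f x ∂((volume.restrict Dᶜ).withDensity (mu j D)) = 0 := by
        refine integral_eq_zero_of_ae ?_
        refine (withDensity_absolutelyContinuous _ _).ae_le ?_
        filter_upwards [ae_restrict_mem hDm.compl] with x hx
        simp [h0 x hx]
      rw [h3, add_zero, setIntegral_eq_integral_of_forall_compl_eq_zero
        (fun x hx => by simp [h0 x hx])] at h1
      simpa using h1
    · exact hφf.mono_measure hle
    · exact hφf.mono_measure (Measure.le_add_left le_rfl)
  rw [Lp.eq_zero_iff_ae_eq_zero]
  filter_upwards [hwf, hout, (refMeasure_absolutelyContinuous j D).ae_le hin] with x h1 h2 h3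
  rw [h1]
  by_cases hx : x ∈ D
  · exact h3 hx
  · exact h2 hx

end IsLevyProfile

end NonlocalForm

end

/-! ### Mollification in the translation invariant form on the whole space. -/

noncomputable section

namespace JumpForm

/-- Translation is continuous in `L²`. -/
theorem tendsto_sqInt_translate {G : Type*} [AddGroup G] [TopologicalSpace G]
    [IsTopologicalAddGroup G] [R1Space G] [MeasurableSpace G] [BorelSpace G] {μ : Measure G}
    [IsLocallyFiniteMeasure μ] [μ.InnerRegularCompactLTTop] [μ.IsAddLeftInvariant] {F : G → ℝ}
    (hF : MemLp F 2 μ) : Tendsto (fun t => sqInt μ fun x => F (t + x) - F x) (𝓝 0) (𝓝 0) := by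
  have : Fact ((2 : ℝ≥0∞) ≠ ∞) := ⟨by simp⟩
  have h1 : Continuous fun t : G => DomAddAct.mk t +ᵥ hF.toLp F :=
    (DomAddAct.continuous_mk).vadd continuous_const
  have h2 := (Lp.tendsto_Lp_iff_tendsto_eLpNorm' _ _).1 (h1.tendsto 0)
  have h3 := ENNReal.Tendsto.pow (n := 2) h2
  refine (h3.congr fun t => ?_).trans (le_of_eq (by simp))
  rw [sqInt_eq_eLpNorm_sq]
  congr 1
  refine eLpNorm_congr_ae ?_
  have h4 := (hF.comp_measurePreserving (measurePreserving_vadd t μ)).coeFn_toLp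
  rw [DomAddAct.mk_vadd_toLp, DomAddAct.mk_zero, zero_vadd]
  filter_upwards [h4, hF.coeFn_toLp] with x hx1 hx2
  rw [Pi.sub_apply, hx2]
  exact congrArg (· - F x) hx1

/-- Jensen's inequality for the square. -/
theorem ofReal_integral_sq_le {Y : Type*} [MeasurableSpace Y] {μ : Measure Y}
    [IsProbabilityMeasure μ] {g : Y → ℝ} (hg : AEStronglyMeasurable g μ) :
    ENNReal.ofReal ((∫ y, g y ∂μ) ^ 2) ≤ sqInt μ g := by
  rw [sqInt_eq_eLpNorm_sq, ← sq_abs, ENNReal.ofReal_pow (abs_nonneg _), ← Real.norm_eq_abs,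
    ofReal_norm]
  gcongr
  refine (enorm_integral_le_lintegral_enorm g).trans ?_
  rw [← eLpNorm_one_eq_lintegral_enorm]
  exact eLpNorm_le_eLpNorm_of_exponent_le (by norm_num) hg

end JumpForm

namespace NonlocalForm

open JumpForm DirichletForm

variable {d : ℕ}

local notation:max "𝔼" n:max => EuclideanSpace ℝ (Fin n)

variable {j : ℝ → ℝ}

namespace IsLevyProfile

theorem sqInt_jumpMeasure_eq_sqInt_mul_sqrt (hj : IsLevyProfile d j) (F : 𝔼 d × 𝔼 d → ℝ) :
    sqInt (jumpMeasure d j) F =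
      sqInt (volume.prod volume) fun p => F p * √(kernelDensity d j p).toReal := by
  rw [hj.sqInt_jumpMeasure, sqInt]
  refine lintegral_congr fun p => ?_
  rw [mul_pow, Real.sq_sqrt ENNReal.toReal_nonneg, ENNReal.ofReal_mul (sq_nonneg _),
    ENNReal.ofReal_toReal (by simp [kernelDensity]), mul_comm]

/-- The kernel depends only on `x - y`, hence is invariant under the shifts `(t, t)`. After
multiplication of `diff u` by `√k` the claim is continuity of translation in the Lebesgue `L²` space
of the product. -/
theorem tendsto_normOne_translate (hj : IsLevyProfile d j) {u : 𝔼 d → ℝ} (hu : Measurable u)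
    (hfin : normOne volume (jumpMeasure d j) u < ∞) :
    Tendsto (fun t => normOne volume (jumpMeasure d j) fun x => u (t + x) - u x)
      (𝓝 0) (𝓝 0) := by
  have hk := hj.measurable_kernelDensity
  let F : 𝔼 d × 𝔼 d → ℝ := fun p => diff u p * √(kernelDensity d j p).toReal
  have hFm : Measurable F := by
    simp only [F, diff]
    fun_prop
  have hF : MemLp F 2 (volume.prod volume) := by
    rw [memLp_two_iff_sqInt_lt_top hFm.aestronglyMeasurable,
      ← hj.sqInt_jumpMeasure_eq_sqInt_mul_sqrt]
    exact lt_of_le_of_lt le_self_add hfin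
  have hL : MemLp u 2 volume := memLp_of_normOne_lt_top hu.aestronglyMeasurable hfin
  have h1 := tendsto_sqInt_translate hF
  have hdiag : Tendsto (fun t : 𝔼 d => (t, t)) (𝓝 0) (𝓝 (0 : 𝔼 d × 𝔼 d)) :=
    Continuous.tendsto (by fun_prop) 0
  have h2 := (h1.comp hdiag).add (tendsto_sqInt_translate hL)
  rw [add_zero] at h2
  refine h2.congr fun t => ?_
  rw [normOne, hj.sqInt_jumpMeasure_eq_sqInt_mul_sqrt]
  congr 1
  simp only [Function.comp_apply]
  congr 1
  funext p
  have : kernelDensity d j ((t, t) + p) = kernelDensity d j p := by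
    simp [kernelDensity, kernel]
  simp only [F, this, diff, Prod.fst_add, Prod.snd_add]
  ring

/-- Functions of finite energy can be approximated by continuous functions. -/
theorem exists_continuous_normOne_sub_lt (hj : IsLevyProfile d j) {u : 𝔼 d → ℝ}
    (hu : Measurable u) (hfin : normOne volume (jumpMeasure d j) u < ∞) {ε : ℝ≥0∞} (hε : 0 < ε) :
    ∃ ψ : 𝔼 d → ℝ, Continuous ψ ∧
      normOne volume (jumpMeasure d j) (fun x => u x - ψ x) ≤ ε := by
  obtain ⟨δ, hδ, hball⟩ := Metric.eventually_nhds_iff.1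
    ((hj.tendsto_normOne_translate hu hfin).eventually_lt_const hε)
  let φ : ContDiffBump (0 : 𝔼 d) := ⟨δ / 2, δ, by linarith, by linarith⟩
  set ρ : 𝔼 d → ℝ := φ.normed volume with hρ
  have hρc : Continuous ρ := φ.continuous_normed
  have hρs : HasCompactSupport ρ := φ.hasCompactSupport_normed
  set P : Measure 𝔼 d := volume.withDensity fun t => ENNReal.ofReal (ρ t) with hP
  have hρm : Measurable fun t => ENNReal.ofReal (ρ t) := hρc.measurable.ennreal_ofReal
  have hprob : IsProbabilityMeasure P := by
    refine ⟨?_⟩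
    rw [hP, withDensity_apply _ MeasurableSet.univ, Measure.restrict_univ,
      ← ofReal_integral_eq_lintegral_ofReal φ.integrable_normed
        (ae_of_all _ φ.nonneg_normed), φ.integral_normed, ENNReal.ofReal_one]
  have hPδ : ∀ᵐ t ∂P, ‖t‖ < δ := by
    rw [hP, ae_withDensity_iff hρm]
    refine ae_of_all _ fun t ht => ?_
    have : t ∈ Function.support ρ := fun h => ht (by simp [h])
    rw [hρ, φ.support_normed_eq] at this
    simpa using this
  have hL : MemLp u 2 volume := memLp_of_normOne_lt_top hu.aestronglyMeasurable hfin
  have hloc : LocallyIntegrable u volume := hL.locallyIntegrable (by norm_num)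
  let ψ : 𝔼 d → ℝ := convolution ρ u (ContinuousLinearMap.lsmul ℝ ℝ) volume
  have hψc : Continuous ψ := hρs.continuous_convolution_left _ hρc hloc
  have hPint : ∀ x, Integrable (fun t => u (x - t)) P := by
    intro x
    rw [hP, integrable_withDensity_iff_integrable_smul' hρm
      (ae_of_all _ fun _ => ENNReal.ofReal_lt_top)]
    refine (hρs.convolutionExists_left (ContinuousLinearMap.lsmul ℝ ℝ) hρc hloc x).congr
      (ae_of_all _ fun t => ?_)
    simp [ENNReal.toReal_ofReal (φ.nonneg_normed t), hρ]
  have hi : ∀ x, Integrable (fun t => u (x - t) - u x) P := fun x =>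
    (hPint x).sub (integrable_const _)
  -- The mollification error is an average of translation errors under the probability measure `P`.
  -- Jensen's inequality bounds its norm by the average of their norms, and each of these is small
  -- because `P` lives on the ball of radius `δ`.
  have hψ : ∀ x, ψ x - u x = ∫ t, (u (x - t) - u x) ∂P := by
    intro x
    rw [integral_sub (hPint x) (integrable_const _), integral_const, hP,
      integral_withDensity_eq_integral_toReal_smul hρm
        (ae_of_all _ fun _ => ENNReal.ofReal_lt_top), ← hP]
    simp only [probReal_univ, one_smul, sub_left_inj, ψ, convolution]
    refine integral_congr_ae (ae_of_all _ fun t => ?_)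
    simp [ENNReal.toReal_ofReal (φ.nonneg_normed t), hρ]
  have hS : SigmaFinite (jumpMeasure d j) := by
    unfold jumpMeasure kernelDensity
    infer_instance
  refine ⟨ψ, hψc, ?_⟩
  rw [normOne_sub_comm]
  have hsq : sqInt volume (fun x => ψ x - u x) ≤
      ∫⁻ t, sqInt volume (fun x => u (x - t) - u x) ∂P := by
    unfold sqInt
    rw [lintegral_lintegral_swap (by unfold Function.uncurry; fun_prop)]
    refine lintegral_mono fun x => ?_
    simp only [hψ]
    exact ofReal_integral_sq_le (hi x).aestronglyMeasurable
  have hen : sqInt (jumpMeasure d j) (diff fun x => ψ x - u x) ≤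
      ∫⁻ t, sqInt (jumpMeasure d j) (diff fun x => u (x - t) - u x) ∂P := by
    unfold sqInt
    rw [lintegral_lintegral_swap (by unfold Function.uncurry diff; fun_prop)]
    refine lintegral_mono fun p => ?_
    simp only [diff, hψ]
    rw [← integral_sub (hi p.1) (hi p.2)]
    exact ofReal_integral_sq_le ((hi p.1).sub (hi p.2)).aestronglyMeasurable
  refine (add_le_add hen hsq).trans ?_
  rw [← lintegral_add_right]
  · have hle : ∀ᵐ t ∂P, sqInt (jumpMeasure d j) (diff fun x => u (x - t) - u x) +
        sqInt volume (fun x => u (x - t) - u x) ≤ ε := by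
      filter_upwards [hPδ] with t ht
      have := (hball (y := -t) (by simpa using ht)).le
      simpa only [normOne, neg_add_eq_sub] using this
    refine (lintegral_mono_ae hle).trans ?_
    simp
  · unfold sqInt
    exact Measurable.lintegral_prod_right' (f := fun q : 𝔼 d × 𝔼 d =>
      ENNReal.ofReal ((u (q.2 - q.1) - u q.2) ^ 2)) (by fun_prop)

end IsLevyProfile

end NonlocalForm

end

/-! ### Truncations, cut-off functions and quasi-continuous versions. -/

noncomputable section

namespace JumpForm

open DirichletForm

/-- Each `|a i - b i|` is at most the square root of the sum, and the supremum is a contraction for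
the uniform distance. -/
theorem ofReal_iSup_sub_iSup_sq_le {ι : Type*} [Nonempty ι] {a b : ι → ℝ}
    (ha : BddAbove (Set.range a)) (hb : BddAbove (Set.range b)) :
    ENNReal.ofReal (((⨆ i, a i) - ⨆ i, b i) ^ 2) ≤ ∑' i, ENNReal.ofReal ((a i - b i) ^ 2) := by
  set S := ∑' i, ENNReal.ofReal ((a i - b i) ^ 2) with hS
  rcases eq_or_ne S ∞ with h | h
  · simp [h]
  have hi : ∀ i, |a i - b i| ≤ √S.toReal := by
    intro i
    refine Real.abs_le_sqrt ?_
    rw [← ENNReal.ofReal_le_iff_le_toReal h]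
    exact ENNReal.le_tsum i
  have h1 : (⨆ i, a i) ≤ (⨆ i, b i) + √S.toReal := ciSup_le fun i => by
    linarith [(abs_le.1 (hi i)).2, le_ciSup hb i]
  have h2 : (⨆ i, b i) ≤ (⨆ i, a i) + √S.toReal := ciSup_le fun i => by
    linarith [(abs_le.1 (hi i)).1, le_ciSup ha i]
  rw [ENNReal.ofReal_le_iff_le_toReal h, ← Real.sq_sqrt (ENNReal.toReal_nonneg (a := S))]
  exact sq_le_sq' (by linarith) (by linarith)

theorem tendsto_zero_of_ofReal_sq {f : ℕ → ℝ}
    (h : Tendsto (fun n => ENNReal.ofReal (f n ^ 2)) atTop (𝓝 0)) : Tendsto f atTop (𝓝 0) := by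
  have h1 := (ENNReal.continuousAt_toReal ENNReal.zero_ne_top).tendsto.comp h
  have h2 : Tendsto (fun n => √(f n ^ 2)) atTop (𝓝 √0) := by
    refine (Real.continuous_sqrt.tendsto 0).comp ?_
    simpa [Function.comp_def, ENNReal.toReal_ofReal (sq_nonneg _)] using h1
  rw [Real.sqrt_zero] at h2
  simp only [Real.sqrt_sq_eq_abs] at h2
  exact (tendsto_zero_iff_abs_tendsto_zero f).2 h2

variable {X : Type*} [MeasurableSpace X] {m : Measure X} {ν : Measure (X × X)}

theorem ae_tsum_lt_top_of_sqInt {ι : Type*} [Countable ι] {f : ι → X → ℝ}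
    (hf : ∀ n, Measurable (f n)) (h : ∑' n, sqInt m (f n) ≠ ∞) :
    ∀ᵐ x ∂m, ∑' n, ENNReal.ofReal (f n x ^ 2) < ∞ := by
  unfold sqInt at h
  rw [← lintegral_tsum fun n => by have := hf n; fun_prop] at h
  exact ae_lt_top' (AEMeasurable.tsum fun n => by have := hf n; fun_prop) h

theorem ae_tendsto_zero_of_tsum_sqInt {f : ℕ → X → ℝ} (hf : ∀ n, Measurable (f n))
    (h : ∑' n, sqInt m (f n) ≠ ∞) : ∀ᵐ x ∂m, Tendsto (fun n => f n x) atTop (𝓝 0) :=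
  (ae_tsum_lt_top_of_sqInt hf h).mono fun _ hx =>
    tendsto_zero_of_ofReal_sq (ENNReal.tendsto_atTop_zero_of_tsum_ne_top hx.ne)

/-- This plays the role of countable subadditivity of capacity. -/
theorem normOne_iSup_le {ι : Type*} [Countable ι] [Nonempty ι] {b : ι → X → ℝ}
    (hb : ∀ i, Measurable (b i)) (hbd : ∀ x, BddAbove (Set.range fun i => b i x)) :
    normOne m ν (fun x => ⨆ i, b i x) ≤ ∑' i, normOne m ν (b i) := by
  simp only [normOne]
  rw [ENNReal.tsum_add]
  refine add_le_add ?_ ?_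
  · unfold sqInt
    rw [← lintegral_tsum fun i => by have := hb i; unfold diff; fun_prop]
    exact lintegral_mono fun p => ofReal_iSup_sub_iSup_sq_le (hbd p.1) (hbd p.2)
  · unfold sqInt
    rw [← lintegral_tsum fun i => by have := hb i; fun_prop]
    refine lintegral_mono fun x => ?_
    simpa using ofReal_iSup_sub_iSup_sq_le (hbd x) (b := fun _ => 0) (by simp)

theorem normOne_const_mul (c : ℝ) (u : X → ℝ) :
    normOne m ν (fun x => c * u x) = ENNReal.ofReal (c ^ 2) * normOne m ν u := by
  simp only [normOne, sqInt, diff, mul_add]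
  rw [← lintegral_const_mul' _ _ ENNReal.ofReal_ne_top,
    ← lintegral_const_mul' _ _ ENNReal.ofReal_ne_top]
  simp only [← ENNReal.ofReal_mul (sq_nonneg c)]
  congr 1
  · exact lintegral_congr fun p => by congr 1; ring
  · exact lintegral_congr fun p => by congr 1; ring

/-- Multiplying a bounded function by cut-off functions of vanishing energy gives functions of
vanishing norm. -/
theorem Compat.tendsto_normOne_mul (h : Compat m ν) {v : X → ℝ} {M : ℝ} (hv : Measurable v)
    (hM : ∀ x, |v x| ≤ M) (hfin : normOne m ν v < ∞) {e : ℕ → X → ℝ}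
    (he : ∀ k, Measurable (e k)) (he1 : ∀ k x, |e k x| ≤ 1)
    (he0 : ∀ᵐ x ∂m, Tendsto (fun k => e k x) atTop (𝓝 0))
    (hen : Tendsto (fun k => sqInt ν (diff (e k))) atTop (𝓝 0)) :
    Tendsto (fun k => normOne m ν fun x => e k x * v x) atTop (𝓝 0) := by
  have h1 : Tendsto (fun k => sqInt m fun x => e k x * v x) atTop (𝓝 0) := by
    refine sqInt_tendsto_zero (g := v) (fun k => by have := he k; fun_prop)
      (lt_of_le_of_lt le_add_self hfin) (fun k => ae_of_all _ fun x => ?_)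
      (he0.mono fun x hx => by simpa using hx.mul_const (v x))
    rw [abs_mul]
    exact mul_le_of_le_one_left (abs_nonneg _) (he1 k x)
  have h2 : Tendsto (fun k => sqInt ν fun p => e k p.1 * diff v p) atTop (𝓝 0) := by
    refine sqInt_tendsto_zero (g := diff v) (fun k => ?_)
      (lt_of_le_of_lt le_self_add hfin) (fun k => ae_of_all _ fun p => ?_)
      ((h.fst.ae he0).mono fun p hp => by simpa using hp.mul_const (diff v p))
    · have := he k
      unfold diff
      exact Measurable.aestronglyMeasurable (by fun_prop)
    · rw [abs_mul]
      exact mul_le_of_le_one_left (abs_nonneg _) (he1 k p.1)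
  have h3 : ∀ k, sqInt ν (diff fun x => e k x * v x) ≤
      2 * (sqInt ν (fun p => e k p.1 * diff v p) +
        ENNReal.ofReal (M ^ 2) * sqInt ν (diff (e k))) := by
    intro k
    -- The first term tends to zero by domination by `diff v`; the second is at most `M²` times the
    -- energy of `e k`.
    have hsplit : (diff fun x => e k x * v x) = fun p : X × X =>
        e k p.1 * diff v p + v p.2 * diff (e k) p := by
      funext p
      simp only [diff]
      ring
    have hek := he k
    rw [hsplit]
    refine (sqInt_add_le (Measurable.aestronglyMeasurable (by unfold diff; fun_prop))).trans ?_
    gcongr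
    unfold sqInt
    rw [← lintegral_const_mul' _ _ ENNReal.ofReal_ne_top]
    refine lintegral_mono fun p => ?_
    rw [← ENNReal.ofReal_mul (sq_nonneg _), mul_pow]
    refine ENNReal.ofReal_le_ofReal ?_
    gcongr ?_ * _
    exact sq_le_sq' (by linarith [abs_le.1 (hM p.2)]) (abs_le.1 (hM p.2)).2
  have h4 : Tendsto (fun k => 2 * (sqInt ν (fun p => e k p.1 * diff v p) +
      ENNReal.ofReal (M ^ 2) * sqInt ν (diff (e k)))) atTop (𝓝 0) := by
    have := ENNReal.Tendsto.const_mul (a := 2)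
      (h2.add (ENNReal.Tendsto.const_mul (a := ENNReal.ofReal (M ^ 2)) hen (by simp))) (by simp)
    simpa using this
  have h5 := tendsto_of_tendsto_of_tendsto_of_le_of_le tendsto_const_nhds h4
    (fun _ => zero_le) h3
  simpa [normOne] using h5.add h1

/-- The function that truncates at height `n` and moves by `1 / n` towards zero. -/
def innerClamp (n : ℕ) (t : ℝ) : ℝ :=
  max (-((n : ℝ) + 1)) (min ((n : ℝ) + 1)
    (t - max (-(1 / ((n : ℝ) + 1))) (min (1 / ((n : ℝ) + 1)) t)))

theorem innerClamp_zero (n : ℕ) : innerClamp n 0 = 0 := by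
  have h1 : (0 : ℝ) < n + 1 := by positivity
  have h2 : (0 : ℝ) < 1 / (n + 1) := by positivity
  simp only [innerClamp]
  grind

/-- Vanishing for small arguments lets an approximant be supported where the function is bounded
away from zero; the truncation makes it bounded, as multiplication by cut-off functions requires. -/
theorem innerClamp_eq_zero {n : ℕ} {t : ℝ} (ht : |t| ≤ 1 / (n + 1)) : innerClamp n t = 0 := by
  have h1 : (0 : ℝ) < n + 1 := by positivity
  have := abs_le.1 ht
  simp only [innerClamp]
  grind

theorem abs_innerClamp_le (n : ℕ) (t : ℝ) : |innerClamp n t| ≤ n + 1 := by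
  have h1 : (0 : ℝ) < n + 1 := by positivity
  rw [abs_le]
  constructor
  · exact le_max_left _ _
  · exact max_le (by linarith) (min_le_left _ _)

theorem abs_innerClamp_sub_le (n : ℕ) (s t : ℝ) : |innerClamp n s - innerClamp n t| ≤ |s - t| := by
  have h1 : (0 : ℝ) < n + 1 := by positivity
  have h2 : (0 : ℝ) < 1 / (n + 1) := by positivity
  simp only [innerClamp]
  generalize (1 / ((n : ℝ) + 1)) = c at h2 ⊢
  generalize ((n : ℝ) + 1) = b at h1 ⊢
  refine (abs_max_sub_max_le_max _ _ _ _).trans ?_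
  refine max_le (by simp) ((abs_min_sub_min_le_max _ _ _ _).trans (max_le (by simp) ?_))
  grind

theorem abs_innerClamp_le_abs (n : ℕ) (t : ℝ) : |innerClamp n t| ≤ |t| := by
  simpa [innerClamp_zero] using abs_innerClamp_sub_le n t 0

theorem measurable_innerClamp (n : ℕ) : Measurable (innerClamp n) := by
  unfold innerClamp
  fun_prop

theorem tendsto_innerClamp (t : ℝ) : Tendsto (fun n => innerClamp n t) atTop (𝓝 t) := by
  have h1 : ∀ᶠ n : ℕ in atTop, |innerClamp n t - t| ≤ 1 / (n + 1) := by
    filter_upwards [eventually_ge_atTop ⌈|t|⌉₊] with n hn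
    have hn' : |t| ≤ n := (Nat.le_ceil _).trans (by exact_mod_cast hn)
    have h2 : (0 : ℝ) < 1 / (n + 1) := by positivity
    have := abs_le.1 hn'
    simp only [innerClamp]
    generalize (1 / ((n : ℝ) + 1)) = c at h2 ⊢
    grind
  rw [tendsto_iff_dist_tendsto_zero]
  refine tendsto_of_tendsto_of_tendsto_of_le_of_le' tendsto_const_nhds
    tendsto_one_div_add_atTop_nhds_zero_nat (Eventually.of_forall fun _ => dist_nonneg) h1

/-- Since `innerClamp n` is a contraction fixing `0`, the functions `2u` and `diff (2u)` dominate,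
and pointwise convergence suffices. -/
theorem Compat.tendsto_normOne_sub_innerClamp (h : Compat m ν) {u : X → ℝ} (hu : Measurable u)
    (hfin : normOne m ν u < ∞) :
    Tendsto (fun n => normOne m ν fun x => u x - innerClamp n (u x)) atTop (𝓝 0) := by
  have hmeas : ∀ n, Measurable fun x => u x - innerClamp n (u x) := fun n =>
    hu.sub ((measurable_innerClamp n).comp hu)
  have htend : ∀ x, Tendsto (fun n => u x - innerClamp n (u x)) atTop (𝓝 0) := fun x => by
    simpa using (tendsto_innerClamp (u x)).const_sub (u x)
  have h2 : ∀ c : ℝ, |2 * c| = |c| + |c| := fun c => by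
    rw [abs_mul, abs_two, two_mul]
  have hfin2 : normOne m ν (fun x => 2 * u x) < ∞ := by
    rw [normOne_const_mul]
    exact ENNReal.mul_lt_top ENNReal.ofReal_lt_top hfin
  have e1 : Tendsto (fun n => sqInt m fun x => u x - innerClamp n (u x)) atTop (𝓝 0) := by
    refine sqInt_tendsto_zero (g := fun x => 2 * u x) (fun n => (hmeas n).aestronglyMeasurable)
      (lt_of_le_of_lt le_add_self hfin2) (fun n => ae_of_all _ fun x => ?_) (ae_of_all _ htend)
    rw [h2]
    exact (abs_sub _ _).trans (add_le_add_right (abs_innerClamp_le_abs n _) _)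
  have e2 : Tendsto (fun n => sqInt ν (diff fun x => u x - innerClamp n (u x)))
      atTop (𝓝 0) := by
    refine sqInt_tendsto_zero (g := diff fun x => 2 * u x)
      (fun n => h.aestronglyMeasurable_diff (hmeas n).aestronglyMeasurable)
      (lt_of_le_of_lt le_self_add hfin2) (fun n => ae_of_all _ fun p => ?_)
      (ae_of_all _ fun p => by simpa [diff] using (htend p.1).sub (htend p.2))
    simp only [diff]
    rw [← mul_sub, h2]
    have := abs_innerClamp_sub_le n (u p.1) (u p.2)
    calc _ = |(u p.1 - u p.2) - (innerClamp n (u p.1) - innerClamp n (u p.2))| := by ring_nf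
      _ ≤ _ := (abs_sub _ _).trans (by gcongr)
  simpa [normOne] using e2.add e1

/-- Countably many functions that are limits of continuous functions have versions that are
continuous on closed sets whose complements carry cut-off functions of vanishing energy. -/
theorem Compat.exists_versions [TopologicalSpace X] [BorelSpace X] (h : Compat m ν)
    {w : ℕ → X → ℝ} (hw : ∀ i, Measurable (w i))
    (happ : ∀ i, ∀ ε > 0, ∃ ψ : X → ℝ, Continuous ψ ∧ normOne m ν (fun x => w i x - ψ x) ≤ ε) :
    ∃ (B : ℕ → Set X) (f : ℕ → X → ℝ) (e : ℕ → X → ℝ),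
      (∀ k, IsClosed (B k)) ∧ Monotone B ∧ (∀ i k, ContinuousOn (f i) (B k)) ∧
      (∀ i, f i =ᵐ[m] w i) ∧ (∀ k, Measurable (e k)) ∧ (∀ k x, e k x ∈ Set.Icc 0 1) ∧
      (∀ k, ∀ x ∉ B k, e k x = 1) ∧ (∀ᵐ x ∂m, Tendsto (fun k => e k x) atTop (𝓝 0)) ∧
      Tendsto (fun k => sqInt ν (diff (e k))) atTop (𝓝 0) := by
  obtain ⟨δ, hδ0, hδ⟩ := ENNReal.exists_pos_sum_of_countable' one_ne_zero (ℕ × ℕ)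
  have h4 : ∀ n : ℕ, (4 : ℝ≥0∞) ^ n ≠ ∞ := fun n => ENNReal.pow_ne_top (by simp)
  -- The divisor `4 ^ n = (2 ^ n) ^ 2` pays for the factor `2 ^ n` in `b`, so the norms of the `b i
  -- n` remain summable over both indices.
  choose ψ hψc hψ using fun i n => happ i (δ (i, n) / 4 ^ n)
    (ENNReal.div_pos (hδ0 _).ne' (h4 n))
  have hψm : ∀ i n, Measurable (ψ i n) := fun i n => (hψc i n).measurable
  let b : ℕ → ℕ → X → ℝ := fun i n x => min 1 |2 ^ n * (ψ i (n + 1) x - ψ i n x)|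
  have hbm : ∀ i n, Measurable (b i n) := fun i n => by
    have := hψm i n
    have := hψm i (n + 1)
    simp only [b, ← Real.norm_eq_abs]
    fun_prop
  have hb0 : ∀ i n x, 0 ≤ b i n x := fun i n x => le_min zero_le_one (abs_nonneg _)
  have hb1 : ∀ i n x, b i n x ≤ 1 := fun i n x => min_le_left _ _
  have hbn : ∀ i n, normOne m ν (b i n) ≤ 2 * (δ (i, n + 1) + δ (i, n)) := by
    intro i n
    have e1 : normOne m ν (b i n) ≤
        normOne m ν fun x => 2 ^ n * (ψ i (n + 1) x - ψ i n x) :=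
      normOne_le_of_contraction (φ := fun t => min 1 |t|) (by simp) (fun s t =>
        (abs_min_sub_min_le_max _ _ _ _).trans
          (max_le (by simp) (abs_abs_sub_abs_le_abs_sub s t))) _
    refine e1.trans ?_
    rw [normOne_const_mul]
    have e2 : ENNReal.ofReal ((2 ^ n) ^ 2) = 4 ^ n := by
      rw [← pow_mul, mul_comm, pow_mul, ENNReal.ofReal_pow (by positivity)]
      norm_num
    have e3 : ∀ n, 4 ^ n * normOne m ν (fun x => w i x - ψ i n x) ≤ δ (i, n) := fun n => by
      rw [mul_comm]
      exact (ENNReal.le_div_iff_mul_le (Or.inl (by simp)) (Or.inl (h4 n))).1 (hψ i n)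
    have e4 : 4 ^ n * normOne m ν (fun x => w i x - ψ i (n + 1) x) ≤ δ (i, n + 1) := by
      refine le_trans ?_ (e3 (n + 1))
      gcongr
      · norm_num
      · exact n.le_succ
    rw [e2]
    calc 4 ^ n * normOne m ν (fun x => ψ i (n + 1) x - ψ i n x)
        ≤ 4 ^ n * (2 * (normOne m ν (fun x => ψ i (n + 1) x - w i x) +
            normOne m ν (fun x => w i x - ψ i n x))) := by
          gcongr
          exact h.normOne_sub_le _ (hψm i _).aestronglyMeasurable (hw i).aestronglyMeasurable
      _ = 2 * (4 ^ n * normOne m ν (fun x => w i x - ψ i (n + 1) x) +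
            4 ^ n * normOne m ν (fun x => w i x - ψ i n x)) := by
          rw [normOne_sub_comm]
          ring
      _ ≤ _ := by
          gcongr
          exact e3 n
  have hsum : ∑' n, ∑' i, normOne m ν (b i n) ≠ ∞ := by
    have e1 : ∑' n, ∑' i, δ (i, n) < ∞ := by
      rw [ENNReal.tsum_comm, ← ENNReal.tsum_prod' (f := δ)]
      exact hδ.trans ENNReal.one_lt_top
    have e2 : ∑' n, ∑' i, δ (i, n + 1) < ∞ :=
      lt_of_le_of_lt (ENNReal.tsum_comp_le_tsum_of_injective (add_left_injective 1)
        (fun n => ∑' i, δ (i, n))) e1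
    refine ne_top_of_le_ne_top ?_ (ENNReal.tsum_le_tsum fun n => ENNReal.tsum_le_tsum
      fun i => hbn i n)
    simp only [ENNReal.tsum_mul_left, ENNReal.tsum_add]
    exact (ENNReal.mul_lt_top (by simp) (ENNReal.add_lt_top.2 ⟨e2, e1⟩)).ne
  -- The norm of `e k` is at most a tail of the convergent double sum.
  let e : ℕ → X → ℝ := fun k x => ⨆ q : ℕ × ℕ, b q.1 (q.2 + k) x
  have hbdd : ∀ k x, BddAbove (Set.range fun q : ℕ × ℕ => b q.1 (q.2 + k) x) := fun k x =>
    ⟨1, by rintro _ ⟨q, rfl⟩; exact hb1 _ _ _⟩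
  have he0 : ∀ k x, 0 ≤ e k x := fun k x => Real.iSup_nonneg fun q => hb0 _ _ _
  have he1 : ∀ k x, e k x ≤ 1 := fun k x => ciSup_le fun q => hb1 _ _ _
  have hen : Tendsto (fun k => normOne m ν (e k)) atTop (𝓝 0) := by
    refine tendsto_of_tendsto_of_tendsto_of_le_of_le tendsto_const_nhds
      (ENNReal.tendsto_sum_nat_add _ hsum) (fun _ => zero_le) fun k => ?_
    refine (normOne_iSup_le (fun q => hbm _ _) (hbdd k)).trans (le_of_eq ?_)
    rw [ENNReal.tsum_prod (f := fun i n => normOne m ν (b i (n + k))), ENNReal.tsum_comm]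
  -- On this set the increments from index `k` on are at most `2 ^ (-n)`, so `ψ i n` converges
  -- uniformly; at a point outside it some `b i n` with `n ≥ k` equals `1`. Where the limit fails to
  -- exist `limUnder` has a default value, which does not matter.
  refine ⟨fun k => {x | ∀ i n, k ≤ n → |2 ^ n * (ψ i (n + 1) x - ψ i n x)| ≤ 1},
    fun i x => limUnder atTop fun n => ψ i n x, e, ?_, ?_, ?_, ?_, ?_, ?_, ?_, ?_, ?_⟩
  · intro k
    simp only [Set.ofPred_forall]
    refine isClosed_iInter fun i => isClosed_iInter fun n => isClosed_iInter fun _ => ?_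
    exact isClosed_le (continuous_const.mul ((hψc i _).sub (hψc i _))).abs continuous_const
  · exact fun k l hkl x hx i n hn => hx i n (hkl.trans hn)
  · intro i k
    have hgeo : ∀ x, (∀ i n, k ≤ n → |2 ^ n * (ψ i (n + 1) x - ψ i n x)| ≤ 1) →
        -- The bound `1 / 2 ^ n` is written as `2 / 2 / 2 ^ n` to fit
        -- `cauchySeq_of_le_geometric_two`.
        ∀ n, dist (ψ i (n + k) x) (ψ i (n + 1 + k) x) ≤ 2 / 2 / 2 ^ n := by
      intro x hx n
      have := hx i (n + k) le_add_self
      rw [abs_mul, abs_pow, abs_two] at this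
      rw [dist_comm, Real.dist_eq, div_self two_ne_zero, le_div_iff₀ (by positivity), mul_comm,
        add_right_comm]
      refine le_trans ?_ this
      gcongr
      · norm_num
      · exact le_self_add
    have hlim : ∀ x, (∀ i n, k ≤ n → |2 ^ n * (ψ i (n + 1) x - ψ i n x)| ≤ 1) →
        Tendsto (fun n => ψ i (n + k) x) atTop (𝓝 (limUnder atTop fun n => ψ i n x)) := by
      intro x hx
      obtain ⟨a, ha⟩ := cauchySeq_tendsto_of_complete (cauchySeq_of_le_geometric_two (hgeo x hx))
      have ha' := (tendsto_add_atTop_iff_nat (f := fun n => ψ i n x) k).1 ha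
      rw [ha'.limUnder_eq]
      exact ha
    have hunif : TendstoUniformlyOn (fun n => ψ i (n + k))
        (fun x => limUnder atTop fun n => ψ i n x) atTop
        {x | ∀ i n, k ≤ n → |2 ^ n * (ψ i (n + 1) x - ψ i n x)| ≤ 1} := by
      rw [Metric.tendstoUniformlyOn_iff]
      intro ε hε
      have ht : Tendsto (fun n : ℕ => (2 : ℝ) / 2 ^ n) atTop (𝓝 0) :=
        tendsto_const_nhds.div_atTop (tendsto_pow_atTop_atTop_of_one_lt one_lt_two)
      filter_upwards [ht.eventually_lt_const hε] with n hn x hx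
      rw [dist_comm]
      exact (dist_le_of_le_geometric_two_of_tendsto (hgeo x hx) (hlim x hx) n).trans_lt hn
    exact hunif.continuousOn (Frequently.of_forall fun n => (hψc i _).continuousOn)
  · intro i
    have hs : ∑' n, sqInt m (fun x => w i x - ψ i n x) ≠ ∞ := by
      refine ne_top_of_le_ne_top (hδ.trans ENNReal.one_lt_top).ne (le_trans
        (ENNReal.tsum_le_tsum fun n => ?_)
        (ENNReal.tsum_comp_le_tsum_of_injective (Prod.mk_right_injective i) δ))
      refine le_trans (le_trans le_add_self (hψ i n)) ?_
      rw [div_eq_mul_inv]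
      refine mul_le_of_le_one_right zero_le (ENNReal.inv_le_one.2 ?_)
      exact one_le_pow₀ (by norm_num)
    filter_upwards [ae_tendsto_zero_of_tsum_sqInt (fun n => (hw i).sub (hψm i n)) hs] with x hx
    refine Tendsto.limUnder_eq ?_
    simpa using hx.const_sub (w i x)
  · exact fun k => Measurable.iSup fun q => hbm _ _
  · exact fun k x => ⟨he0 k x, he1 k x⟩
  · intro k x hx
    simp only [Set.mem_ofPred_eq, not_forall, not_le] at hx
    obtain ⟨i, n, hkn, hlt⟩ := hx
    refine le_antisymm (he1 k x) ?_
    refine le_trans ?_ (le_ciSup (hbdd k x) (i, n - k))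
    simp only [b, Nat.sub_add_cancel hkn]
    exact le_min le_rfl hlt.le
  · have hs : ∑' q : ℕ × ℕ, sqInt m (b q.2 q.1) ≠ ∞ := by
      rw [ENNReal.tsum_prod (f := fun n i => sqInt m (b i n))]
      exact ne_top_of_le_ne_top hsum (ENNReal.tsum_le_tsum fun n => ENNReal.tsum_le_tsum fun i =>
        le_add_self)
    filter_upwards [ae_tsum_lt_top_of_sqInt (fun q : ℕ × ℕ => hbm q.2 q.1) hs] with x hx
    rw [ENNReal.tsum_prod (f := fun n i => ENNReal.ofReal (b i n x ^ 2))] at hx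
    refine tendsto_zero_of_ofReal_sq (tendsto_of_tendsto_of_tendsto_of_le_of_le
      tendsto_const_nhds (ENNReal.tendsto_sum_nat_add _ hx.ne) (fun _ => zero_le) fun k => ?_)
    have := ofReal_iSup_sub_iSup_sq_le (hbdd k x) (b := fun _ => 0) (by simp)
    simp only [ciSup_const, sub_zero] at this
    refine this.trans (le_of_eq ?_)
    rw [ENNReal.tsum_prod (f := fun i n => ENNReal.ofReal (b i (n + k) x ^ 2)),
      ENNReal.tsum_comm]
  · exact tendsto_of_tendsto_of_tendsto_of_le_of_le tendsto_const_nhds hen (fun _ => zero_le)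
      fun k => le_self_add

end JumpForm

end

/-! ### Gluing an inner nest to the exhaustion of the exterior. -/

noncomputable section

namespace NonlocalForm

open JumpForm DirichletForm

variable {d : ℕ}

local notation:max "𝔼" n:max => EuclideanSpace ℝ (Fin n)

variable {j : ℝ → ℝ} {D : Set 𝔼 d}

theorem exists_two_mul_add_lt {ε : ℝ≥0∞} (hε : 0 < ε) :
    ∃ η > 0, ∀ a b : ℝ≥0∞, a < η → b < η → 2 * (a + b) < ε := by
  refine ⟨ε / 4, ENNReal.div_pos hε.ne' (by simp), fun a b ha hb => ?_⟩
  have h1 : a + b < ε / 4 + ε / 4 := ENNReal.add_lt_add ha hb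
  have h2 : 2 * (a + b) < 2 * (ε / 4 + ε / 4) :=
    (ENNReal.mul_lt_mul_iff_right two_ne_zero (by simp)).2 h1
  refine h2.trans_le (le_of_eq ?_)
  rw [← two_mul, ← mul_assoc, ENNReal.div_eq_inv_mul, ← mul_assoc]
  norm_num
  rw [ENNReal.mul_inv_cancel (by simp) (by simp), one_mul]

/-! ### The exterior of `D` -/

/-- The points of norm at most `k` and of distance at least `1 / (k + 1)` from `D`. -/
def outerSet (D : Set 𝔼 d) (k : ℕ) : Set 𝔼 d :=
  {x | 1 / ((k : ℝ) + 1) ≤ Metric.infDist x D ∧ ‖x‖ ≤ k}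

theorem isClosed_outerSet (D : Set 𝔼 d) (k : ℕ) : IsClosed (outerSet D k) :=
  (isClosed_le continuous_const (Metric.continuous_infDist_pt D)).inter
    (isClosed_le continuous_norm continuous_const)

theorem isCompact_outerSet (D : Set 𝔼 d) (k : ℕ) : IsCompact (outerSet D k) :=
  (isCompact_closedBall (0 : 𝔼 d) k).of_isClosed_subset (isClosed_outerSet D k)
    fun x hx => by simpa using hx.2

theorem monotone_outerSet (D : Set 𝔼 d) : Monotone (outerSet D) := by
  intro k l hkl x hx
  have hkl' : (k : ℝ) ≤ l := by exact_mod_cast hkl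
  refine ⟨le_trans ?_ hx.1, hx.2.trans hkl'⟩
  gcongr

theorem infDist_pos_of_mem_outerSet {k : ℕ} {x : 𝔼 d} (hx : x ∈ outerSet D k) :
    0 < Metric.infDist x D :=
  lt_of_lt_of_le (by positivity) hx.1

theorem notMem_closure_of_mem_outerSet {k : ℕ} {x : 𝔼 d} (hx : x ∈ outerSet D k) :
    x ∉ closure D := fun h =>
  (infDist_pos_of_mem_outerSet hx).ne' (by
    rw [← Metric.infDist_closure, Metric.infDist_zero_of_mem h])

theorem eventually_mem_outerSet (hne : D.Nonempty) {x : 𝔼 d} (hx : x ∉ closure D) :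
    ∀ᶠ k in atTop, x ∈ outerSet D k := by
  have hpos := (Metric.infDist_pos_iff_notMem_closure hne).1 hx
  have h1 := (tendsto_one_div_add_atTop_nhds_zero_nat (𝕜 := ℝ)).eventually_lt_const hpos
  filter_upwards [h1, eventually_ge_atTop ⌈‖x‖⌉₊] with k hk1 hk2
  exact ⟨hk1.le, (Nat.le_ceil _).trans (by exact_mod_cast hk2)⟩

theorem outerSet_subset_interior (D : Set 𝔼 d) (k : ℕ) :
    outerSet D k ⊆ interior (outerSet D (k + 1)) := by
  have hopen : IsOpen {x : 𝔼 d | 1 / (((k + 1 : ℕ) : ℝ) + 1) < Metric.infDist x D ∧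
      ‖x‖ < ((k + 1 : ℕ) : ℝ)} :=
    (isOpen_lt continuous_const (Metric.continuous_infDist_pt D)).inter
      (isOpen_lt continuous_norm continuous_const)
  have hsub : {x : 𝔼 d | 1 / (((k + 1 : ℕ) : ℝ) + 1) < Metric.infDist x D ∧
      ‖x‖ < ((k + 1 : ℕ) : ℝ)} ⊆ outerSet D (k + 1) := fun y hy => ⟨hy.1.le, hy.2.le⟩
  refine fun x hx => interior_maximal hsub hopen ⟨?_, ?_⟩
  · refine lt_of_lt_of_le ?_ hx.1
    push_cast
    gcongr
    linarith
  · refine lt_of_le_of_lt hx.2 ?_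
    push_cast
    linarith

theorem exists_cutoff (D : Set 𝔼 d) (k : ℕ) : ∃ χ : 𝔼 d → ℝ, Continuous χ ∧
    (∀ x ∈ outerSet D k, χ x = 1) ∧ (∀ x ∉ outerSet D (k + 1), χ x = 0) ∧
    ∀ x, |χ x| ≤ 1 := by
  obtain ⟨χ, h1, h0, -, hI⟩ := exists_continuous_one_zero_of_isCompact (isCompact_outerSet D k)
    (t := (interior (outerSet D (k + 1)))ᶜ) isOpen_interior.isClosed_compl
    (Set.disjoint_compl_right_iff_subset.2 (outerSet_subset_interior D k))
  refine ⟨χ, χ.continuous, fun x hx => h1 hx, fun x hx => h0 fun h => hx (interior_subset h),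
    fun x => ?_⟩
  rw [abs_of_nonneg (hI x).1]
  exact (hI x).2

/-- The union of the part of `B` in the closure of `D` and the exterior sets. -/
def glue (D : Set 𝔼 d) (B : ℕ → Set 𝔼 d) (k : ℕ) : Set 𝔼 d :=
  (B k ∩ closure D) ∪ outerSet D k

theorem isCompact_glue (hb : Bornology.IsBounded D) {B : ℕ → Set 𝔼 d} (hB : ∀ k, IsClosed (B k))
    (k : ℕ) : IsCompact (glue D B k) :=
  ((Metric.isCompact_of_isClosed_isBounded isClosed_closure hb.closure).inter_left (hB k)).union
    (isCompact_outerSet D k)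

theorem monotone_glue (D : Set 𝔼 d) {B : ℕ → Set 𝔼 d} (hB : Monotone B) : Monotone (glue D B) :=
  fun _ _ h => Set.union_subset_union (Set.inter_subset_inter_left _ (hB h))
    (monotone_outerSet D h)

open scoped Classical in
-- The exterior piece stays at positive distance from `D`, so the two closed pieces are disjoint and
-- `f` and `h` need not agree on the boundary.
theorem continuousOn_piecewise_glue {B : ℕ → Set 𝔼 d} (hB : ∀ k, IsClosed (B k)) {k : ℕ}
    {f h : 𝔼 d → ℝ} (hf : ContinuousOn f (B k)) (hh : ContinuousOn h (outerSet D k)) :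
    ContinuousOn ((closure D).piecewise f h) (glue D B k) := by
  refine ContinuousOn.union_of_isClosed ?_ ?_ ((hB k).inter isClosed_closure)
    (isClosed_outerSet D k)
  · exact (hf.mono Set.inter_subset_left).congr fun x hx => Set.piecewise_eq_of_mem _ _ _ hx.2
  · exact hh.congr fun x hx =>
      Set.piecewise_eq_of_notMem _ _ _ (notMem_closure_of_mem_outerSet hx)

/-- `B` is a nest for the functions that vanish off `D`. -/
structure IsInnerNest (j : ℝ → ℝ) (D : Set 𝔼 d) (B : ℕ → Set 𝔼 d) : Prop where
  isClosed : ∀ k, IsClosed (B k)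
  mono : Monotone B
  approx : ∀ u : 𝔼 d → ℝ, Measurable u → (∀ x ∉ D, u x = 0) →
    normOne volume (jumpMeasure d j) u < ∞ → ∀ ε > 0, ∃ k, ∃ g : 𝔼 d → ℝ, Measurable g ∧
      (∀ x ∉ D, g x = 0) ∧ (∀ᵐ x, x ∉ B k → g x = 0) ∧
      normOne volume (jumpMeasure d j) (fun x => u x - g x) < ε

/-- `B` is an increasing sequence of closed sets and `e k` are cut-off functions that equal `1`
off `B k` and have vanishing energy. -/
structure IsCutoffNest (j : ℝ → ℝ) (B : ℕ → Set 𝔼 d) (e : ℕ → 𝔼 d → ℝ) : Prop where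
  isClosed : ∀ k, IsClosed (B k)
  mono : Monotone B
  measurable : ∀ k, Measurable (e k)
  mem_Icc : ∀ k x, e k x ∈ Set.Icc 0 1
  eq_one : ∀ k, ∀ x ∉ B k, e k x = 1
  tendsto : ∀ᵐ x, Tendsto (fun k => e k x) atTop (𝓝 0)
  tendsto_energy : Tendsto (fun k => sqInt (jumpMeasure d j) (diff (e k))) atTop (𝓝 0)

/-- The approximant vanishes off `B k` and also wherever `u` does, in particular off `D`. Clamping
comes first because the cut-off step needs a bounded function. -/
theorem IsCutoffNest.exists_approx {B : ℕ → Set 𝔼 d} {e : ℕ → 𝔼 d → ℝ}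
    (hB : IsCutoffNest j B e) {u : 𝔼 d → ℝ} (hu : Measurable u)
    (hfin : normOne volume (jumpMeasure d j) u < ∞) {ε : ℝ≥0∞} (hε : 0 < ε) :
    ∃ n k, normOne volume (jumpMeasure d j)
      (fun x => u x - (1 - e k x) * innerClamp n (u x)) < ε := by
  have hc := IsLevyProfile.compat_volume (d := d) j
  obtain ⟨η, hη, hlt⟩ := exists_two_mul_add_lt hε
  obtain ⟨n, hn⟩ := ((hc.tendsto_normOne_sub_innerClamp hu hfin).eventually_lt_const hη).exists
  have hv : Measurable fun x => innerClamp n (u x) := (measurable_innerClamp n).comp hu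
  have hvfin : normOne volume (jumpMeasure d j) (fun x => innerClamp n (u x)) < ∞ :=
    (normOne_le_of_contraction (innerClamp_zero n) (abs_innerClamp_sub_le n) u).trans_lt hfin
  obtain ⟨k, hk⟩ := ((hc.tendsto_normOne_mul hv (fun x => abs_innerClamp_le n (u x)) hvfin
    hB.measurable (fun k x => by rw [abs_of_nonneg (hB.mem_Icc k x).1]; exact (hB.mem_Icc k x).2)
    hB.tendsto hB.tendsto_energy).eventually_lt_const hη).exists
  refine ⟨n, k, lt_of_le_of_lt ?_ (hlt _ _ hn hk)⟩
  refine le_trans (le_of_eq ?_) (hc.normOne_add_le (hu.sub hv).aestronglyMeasurable)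
  congr 1
  funext x
  ring

theorem IsCutoffNest.isInnerNest {B : ℕ → Set 𝔼 d} {e : ℕ → 𝔼 d → ℝ}
    (hB : IsCutoffNest j B e) (D : Set 𝔼 d) : IsInnerNest j D B where
  isClosed := hB.isClosed
  mono := hB.mono
  approx u hu h0 hfin ε hε := by
    obtain ⟨n, k, hlt⟩ := hB.exists_approx hu hfin hε
    refine ⟨k, _, ?_, fun x hx => ?_, ae_of_all _ fun x hx => ?_, hlt⟩
    · exact (measurable_const.sub (hB.measurable k)).mul ((measurable_innerClamp n).comp hu)
    · simp [h0 x hx, innerClamp_zero]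
    · simp [hB.eq_one k x hx]

/-- The part of `B k` where one of the first `k` functions is at least `1 / (k + 1)`. -/
def nonvanishing (B : ℕ → Set 𝔼 d) (f : ℕ → 𝔼 d → ℝ) (k : ℕ) : Set 𝔼 d :=
  ⋃ i ∈ Set.Iic k, B k ∩ f i ⁻¹' {t | 1 / ((k : ℝ) + 1) ≤ |t|}

theorem mem_nonvanishing {B : ℕ → Set 𝔼 d} {f : ℕ → 𝔼 d → ℝ} {k : ℕ} {x : 𝔼 d} :
    x ∈ nonvanishing B f k ↔ x ∈ B k ∧ ∃ i ≤ k, 1 / ((k : ℝ) + 1) ≤ |f i x| := by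
  simp only [nonvanishing, Set.mem_iUnion, Set.mem_Iic, Set.mem_inter_iff, Set.mem_preimage,
    Set.mem_ofPred_eq]
  tauto

/-- Common zeros of the `f i` can be removed: an element close to some `w i` is close to a clamped
and cut-off `w i`, which vanishes where `|w i|` is small. On `closure D` this makes the set of
common zeros polar after gluing. -/
theorem IsCutoffNest.isInnerNest_nonvanishing {B : ℕ → Set 𝔼 d} {e : ℕ → 𝔼 d → ℝ}
    (hB : IsCutoffNest j B e) {D : Set 𝔼 d} {w f : ℕ → 𝔼 d → ℝ} (hw : ∀ i, Measurable (w i))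
    (hw0 : ∀ i, ∀ x ∉ D, w i x = 0) (hwfin : ∀ i, normOne volume (jumpMeasure d j) (w i) < ∞)
    (hf : ∀ i k, ContinuousOn (f i) (B k)) (hfw : ∀ i, f i =ᵐ[volume] w i)
    (hdense : ∀ u : 𝔼 d → ℝ, Measurable u → (∀ x ∉ D, u x = 0) →
      normOne volume (jumpMeasure d j) u < ∞ → ∀ ε > 0, ∃ i,
        normOne volume (jumpMeasure d j) (fun x => u x - w i x) < ε) :
    IsInnerNest j D (nonvanishing B f) where
  isClosed k := by
    refine (Set.finite_Iic k).isClosed_biUnion fun i _ => ?_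
    exact (hf i k).preimage_isClosed_of_isClosed (hB.isClosed k)
      (isClosed_le continuous_const continuous_abs)
  mono k l hkl x hx := by
    rw [mem_nonvanishing] at hx ⊢
    obtain ⟨hxB, i, hi, hle⟩ := hx
    refine ⟨hB.mono hkl hxB, i, hi.trans hkl, le_trans ?_ hle⟩
    gcongr
  approx u hu h0 hfin ε hε := by
    obtain ⟨η, hη, hlt⟩ := exists_two_mul_add_lt hε
    obtain ⟨i, hi⟩ := hdense u hu h0 hfin η hη
    obtain ⟨n, k, hnk⟩ := hB.exists_approx (hw i) (hwfin i) hη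
    refine ⟨max i (max n k), fun x => (1 - e k x) * innerClamp n (w i x), ?_, fun x hx => ?_, ?_,
      lt_of_le_of_lt ?_ (hlt _ _ hi hnk)⟩
    · exact (measurable_const.sub (hB.measurable k)).mul ((measurable_innerClamp n).comp (hw i))
    · simp [hw0 i x hx, innerClamp_zero]
    · filter_upwards [hfw i] with x hfx hx
      by_cases hxk : x ∈ B k
      · have hlt' : |w i x| ≤ 1 / ((n : ℝ) + 1) := by
          by_contra hcon
          rw [not_le] at hcon
          refine hx (mem_nonvanishing.2 ⟨hB.mono ((le_max_right _ _).trans (le_max_right _ _)) hxk,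
            i, le_max_left _ _, ?_⟩)
          rw [hfx]
          refine le_trans ?_ hcon.le
          have : (n : ℝ) ≤ (max i (max n k) : ℕ) := by
            exact_mod_cast (le_max_left n k).trans (le_max_right _ _)
          gcongr
        simp [innerClamp_eq_zero hlt']
      · simp [hB.eq_one k x hxk]
    · exact (IsLevyProfile.compat_volume j).normOne_sub_le _ hu.aestronglyMeasurable
        (hw i).aestronglyMeasurable

namespace IsLevyProfile

theorem exists_cutoffNest (hj : IsLevyProfile d j) {w : ℕ → 𝔼 d → ℝ}
    (hw : ∀ i, Measurable (w i)) (hwfin : ∀ i, normOne volume (jumpMeasure d j) (w i) < ∞) :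
    ∃ (B : ℕ → Set 𝔼 d) (f e : ℕ → 𝔼 d → ℝ), IsCutoffNest j B e ∧
      (∀ i k, ContinuousOn (f i) (B k)) ∧ ∀ i, f i =ᵐ[volume] w i := by
  obtain ⟨B, f, e, h1, h2, h3, h4, h5, h6, h7, h8, h9⟩ := (compat_volume j).exists_versions hw
    fun i ε hε => hj.exists_continuous_normOne_sub_lt (hw i) (hwfin i) hε
  exact ⟨B, f, e, ⟨h1, h2, h5, h6, h7, h8, h9⟩, h3, h4⟩

theorem refMeasure_outerSet_lt_top (hj : IsLevyProfile d j) (hD : MeasurableSet D)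
    (hb : Bornology.IsBounded D) (k : ℕ) : refMeasure j D (outerSet D k) < ∞ := by
  have hm := (isClosed_outerSet D k).measurableSet
  have hle : refMeasure j D (outerSet D k) ≤ volume D +
      ENNReal.ofReal (j (1 / ((k : ℝ) + 1))) * volume D * volume (outerSet D k) := by
    rw [refMeasure, Measure.add_apply, withDensity_apply _ hm, Measure.restrict_restrict hm]
    refine add_le_add ((measure_mono (Set.subset_univ _)).trans (by simp)) ?_
    have : ∫⁻ x in outerSet D k ∩ Dᶜ, mu j D x ≤
        ∫⁻ _ in outerSet D k, ENNReal.ofReal (j (1 / ((k : ℝ) + 1))) * volume D :=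
      (lintegral_mono_set Set.inter_subset_left).trans
        (setLIntegral_mono' hm fun x hx => hj.mu_le (by positivity) hx.1 hD)
    simpa [mul_comm] using this
  refine hle.trans_lt (ENNReal.add_lt_top.2 ⟨hb.measure_lt_top, ENNReal.mul_lt_top
    (ENNReal.mul_lt_top ENNReal.ofReal_lt_top hb.measure_lt_top)
    (isCompact_outerSet D k).measure_lt_top⟩)

theorem ae_notMem_frontier (hfr : volume (frontier D) = 0) :
    ∀ᵐ x ∂(refMeasure j D), x ∉ frontier D :=
  (refMeasure_absolutelyContinuous j D).ae_le (measure_eq_zero_iff_ae_notMem.1 hfr)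

theorem normOne_indicator_compl_lt_top (hj : IsLevyProfile d j) (hD : MeasurableSet D)
    {u : 𝔼 d → ℝ} (hu : Measurable u)
    (hfin : normOne (refMeasure j D) (innerJumpMeasure j D) u < ∞) :
    normOne (refMeasure j D) (innerJumpMeasure j D) (Dᶜ.indicator u) < ∞ := by
  refine (hj.normOne_le_of_zero_on hD (hu.indicator hD.compl) fun x hx => by simp [hx]).trans_lt
    (ENNReal.mul_lt_top (by simp) (lt_of_le_of_lt ?_ (lt_of_le_of_lt le_add_self hfin)))
  refine sqInt_mono_abs (ae_of_all _ fun x => ?_)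
  by_cases hx : x ∈ D <;> simp [hx]

/-- The exterior part `1_{Dᶜ} u` has finite norm because it is in `L²(m)`; subtracting it from `u`
leaves the inner part, whose norm is that of the whole-space form. -/
theorem normOne_indicator_lt_top (hj : IsLevyProfile d j) (hD : IsOpen D) (hne : D.Nonempty)
    {u : 𝔼 d → ℝ} (hu : Measurable u)
    (hfin : normOne (refMeasure j D) (innerJumpMeasure j D) u < ∞) :
    normOne volume (jumpMeasure d j) (D.indicator u) < ∞ := by
  rw [← hj.normOne_eq_of_zero_off hD.measurableSet (hu.indicator hD.measurableSet)
    fun x hx => by simp [hx]]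
  refine (hj.compat hD hne).normOne_lt_top_of_sub hu.aestronglyMeasurable hfin ?_
  convert! hj.normOne_indicator_compl_lt_top hD.measurableSet hu hfin using 2
  funext x
  by_cases hx : x ∈ D <;> simp [hx]

theorem tendsto_normOne_indicator_outerSet (hj : IsLevyProfile d j) (hD : IsOpen D)
    (hne : D.Nonempty) (hfr : volume (frontier D) = 0) {u : 𝔼 d → ℝ} (hu : Measurable u)
    (hfin : normOne (refMeasure j D) (innerJumpMeasure j D) u < ∞) :
    Tendsto (fun k => normOne (refMeasure j D) (innerJumpMeasure j D)
      fun x => Dᶜ.indicator u x - (outerSet D k).indicator u x) atTop (𝓝 0) := by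
  have hDm := hD.measurableSet
  have hm : ∀ k, Measurable fun x => Dᶜ.indicator u x - (outerSet D k).indicator u x := fun k =>
    (hu.indicator hDm.compl).sub (hu.indicator (isClosed_outerSet D k).measurableSet)
  have hsub : ∀ k, ∀ x ∈ D, x ∉ outerSet D k := fun k x hx h =>
    notMem_closure_of_mem_outerSet h (subset_closure hx)
  have h1 : Tendsto (fun k => sqInt (refMeasure j D)
      fun x => Dᶜ.indicator u x - (outerSet D k).indicator u x) atTop (𝓝 0) := by
    refine sqInt_tendsto_zero (g := u) (fun k => (hm k).aestronglyMeasurable)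
      (lt_of_le_of_lt le_add_self hfin) (fun k => ae_of_all _ fun x => ?_) ?_
    · by_cases hx : x ∈ D
      · simp [hx, hsub k x hx]
      · by_cases hxk : x ∈ outerSet D k <;> simp [hx, hxk]
    · filter_upwards [ae_notMem_frontier hfr] with x hx
      refine tendsto_const_nhds.congr' ?_
      by_cases hxD : x ∈ D
      · exact Eventually.of_forall fun k => by simp [hxD, hsub k x hxD]
      · have hxc : x ∉ closure D := fun h => hx (by rw [hD.frontier_eq]; exact ⟨h, hxD⟩)
        filter_upwards [eventually_mem_outerSet hne hxc] with k hk
        simp [hxD, hk]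
  have h2 := ENNReal.Tendsto.const_mul (a := 3) h1 (by simp)
  rw [mul_zero] at h2
  exact tendsto_of_tendsto_of_tendsto_of_le_of_le tendsto_const_nhds h2 (fun _ => zero_le)
    fun k => hj.normOne_le_of_zero_on hDm (hm k) fun x hx => by simp [hx, hsub k x hx]

/-- The inner part of `u` is approximated by the inner nest and the exterior part by restriction to
`outerSet D l`. -/
theorem isNest_glue (hj : IsLevyProfile d j) (hD : IsOpen D) (hne : D.Nonempty)
    (hfr : volume (frontier D) = 0) {B : ℕ → Set 𝔼 d} (hB : IsInnerNest j D B) :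
    IsNest (jumpDomain (refMeasure j D) (innerJumpMeasure j D))
      (jumpForm (refMeasure j D) (innerJumpMeasure j D)) (glue D B) := by
  have hc := hj.compat hD hne
  have hDm := hD.measurableSet
  refine hc.isNest (fun k => ((hB.isClosed k).inter isClosed_closure).union
    (isClosed_outerSet D k)) (monotone_glue D hB.mono) fun u hu hfin ε hε => ?_
  obtain ⟨η, hη, hlt⟩ := exists_two_mul_add_lt hε
  obtain ⟨k, g, hgm, hg0, hgB, hg⟩ := hB.approx (D.indicator u) (hu.indicator hDm)
    (fun x hx => by simp [hx]) (hj.normOne_indicator_lt_top hD hne hu hfin) η hη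
  -- Taking `l ≥ k` lets one member of the glued nest carry both approximants.
  obtain ⟨l, hl, hkl⟩ := (((hj.tendsto_normOne_indicator_outerSet hD hne hfr hu
    hfin).eventually_lt_const hη).and (eventually_ge_atTop k)).exists
  have hdm : Measurable fun x => D.indicator u x - g x := (hu.indicator hDm).sub hgm
  refine ⟨l, fun x => g x + (outerSet D l).indicator u x,
    (hgm.add (hu.indicator (isClosed_outerSet D l).measurableSet)).aestronglyMeasurable, ?_, ?_⟩
  · filter_upwards [(refMeasure_absolutelyContinuous j D).ae_le hgB] with x hx hxA
    have hx2 : x ∉ outerSet D l := fun h => hxA (Or.inr h)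
    rw [Set.indicator_of_notMem hx2, add_zero]
    by_cases hxD : x ∈ D
    · exact hx fun h => hxA (Or.inl ⟨hB.mono hkl h, subset_closure hxD⟩)
    · exact hg0 x hxD
  · rw [← hj.normOne_eq_of_zero_off hDm hdm fun x hx => by simp [hx, hg0 x hx]] at hg
    refine lt_of_le_of_lt (le_trans (le_of_eq ?_)
      (hc.normOne_add_le hdm.aestronglyMeasurable)) (hlt _ _ hg hl)
    congr 1
    funext x
    by_cases hx : x ∈ D
    · simp only [hx, Set.indicator_of_mem, Set.mem_compl_iff, not_true_eq_false,
        not_false_eq_true, Set.indicator_of_notMem]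
      ring
    · simp only [hx, Set.indicator_of_mem, Set.mem_compl_iff, not_false_eq_true,
        Set.indicator_of_notMem]
      ring

/-- Functions on the exterior can be approximated by continuous functions. -/
theorem exists_continuous_outer (hj : IsLevyProfile d j) (hD : IsOpen D) (hne : D.Nonempty)
    (hb : Bornology.IsBounded D) (hfr : volume (frontier D) = 0) {u : 𝔼 d → ℝ}
    (hu : Measurable u) (hfin : normOne (refMeasure j D) (innerJumpMeasure j D) u < ∞)
    {ε : ℝ≥0∞} (hε : 0 < ε) :
    ∃ h : 𝔼 d → ℝ, Continuous h ∧ (∀ x ∈ closure D, h x = 0) ∧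
      normOne (refMeasure j D) (innerJumpMeasure j D) (fun x => Dᶜ.indicator u x - h x) < ε := by
  have hc := hj.compat hD hne
  have hDm := hD.measurableSet
  obtain ⟨η, hη, hlt⟩ := exists_two_mul_add_lt hε
  obtain ⟨k, hk⟩ := ((hj.tendsto_normOne_indicator_outerSet hD hne hfr hu
    hfin).eventually_lt_const hη).exists
  obtain ⟨χ, hχc, hχ1, hχ0, hχb⟩ := exists_cutoff D k
  set L := outerSet D (k + 1) with hL
  set v := (outerSet D k).indicator u with hv
  have hLm : MeasurableSet L := (isClosed_outerSet D (k + 1)).measurableSet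
  have hvm : Measurable v := hu.indicator (isClosed_outerSet D k).measurableSet
  have hfinL : IsFiniteMeasure ((refMeasure j D).restrict L) :=
    ⟨by simpa using hj.refMeasure_outerSet_lt_top hDm hb (k + 1)⟩
  have hvL : MemLp v 2 ((refMeasure j D).restrict L) :=
    ((memLp_of_normOne_lt_top hu.aestronglyMeasurable hfin).indicator
      (isClosed_outerSet D k).measurableSet).restrict L
  -- The factor `3` is the constant of `normOne_le_of_zero_on`, which reduces the task to
  -- approximation in `L²(m)` on a set of finite measure.
  obtain ⟨δ, hδ0, hδ⟩ : ∃ δ : ℝ≥0∞, δ ≠ 0 ∧ 3 * δ ^ 2 < η := by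
    have ht : Tendsto (fun δ : ℝ≥0∞ => 3 * δ ^ 2) (𝓝[≠] 0) (𝓝 0) := by
      have : Tendsto (fun δ : ℝ≥0∞ => 3 * δ ^ 2) (𝓝 0) (𝓝 (3 * 0 ^ 2)) :=
        ENNReal.Tendsto.const_mul (ENNReal.Tendsto.pow tendsto_id) (by simp)
      simpa using this.mono_left nhdsWithin_le_nhds
    obtain ⟨δ, h1, h2⟩ := ((ht.eventually_lt_const hη).and self_mem_nhdsWithin).exists
    exact ⟨δ, h2, h1⟩
  obtain ⟨f, hf, -⟩ := hvL.exists_boundedContinuous_eLpNorm_sub_le (by simp) hδ0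
  have hsub : ∀ x ∈ closure D, ∀ n, x ∉ outerSet D n := fun x hx n h =>
    notMem_closure_of_mem_outerSet h hx
  refine ⟨fun x => χ x * f x, hχc.mul f.continuous, fun x hx => ?_, ?_⟩
  · simp [hχ0 x (hsub x hx _)]
  have hsq : sqInt (refMeasure j D) (fun x => v x - χ x * f x) ≤ δ ^ 2 := by
    have e1 : sqInt (refMeasure j D) (fun x => v x - χ x * f x) =
        sqInt ((refMeasure j D).restrict L) (fun x => v x - χ x * f x) := by
      refine (setLIntegral_eq_of_support_subset fun x hx => ?_).symm
      by_contra hxL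
      refine hx ?_
      have : x ∉ outerSet D k := fun h => hxL (monotone_outerSet D k.le_succ h)
      simp [hv, hχ0 x hxL, this]
    have e2 : sqInt ((refMeasure j D).restrict L) (fun x => v x - χ x * f x) ≤
        sqInt ((refMeasure j D).restrict L) (v - ⇑f) := by
      refine sqInt_mono_abs (ae_of_all _ fun x => ?_)
      by_cases hx : x ∈ outerSet D k
      · simp [hχ1 x hx]
      · simp only [hv, Set.indicator_of_notMem hx, zero_sub, abs_neg, Pi.sub_apply, abs_mul]
        exact mul_le_of_le_one_left (abs_nonneg _) (hχb x)
    rw [e1]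
    refine e2.trans ?_
    rw [sqInt_eq_eLpNorm_sq]
    gcongr
  have hgm : Measurable fun x => v x - χ x * f x :=
    hvm.sub (hχc.measurable.mul f.continuous.measurable)
  have hN := (hj.normOne_le_of_zero_on hDm hgm fun x hx => by
    simp [hv, hsub x (subset_closure hx), hχ0 x (hsub x (subset_closure hx) _)]).trans_lt
      (lt_of_le_of_lt (by gcongr) hδ)
  exact (hc.normOne_sub_le v (hu.indicator hDm.compl).aestronglyMeasurable
    hvm.aestronglyMeasurable).trans_lt (hlt _ _ hk hN)

end IsLevyProfile

end NonlocalForm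

end

/-! ### Quasi-continuous versions and separation of points. -/

noncomputable section

namespace NonlocalForm

open JumpForm DirichletForm

variable {d : ℕ}

local notation:max "𝔼" n:max => EuclideanSpace ℝ (Fin n)

variable {j : ℝ → ℝ} {D : Set 𝔼 d}

/-- The constant `1` and the coordinate functions truncated at height `R`. -/
def truncCoord (R : ℝ) : Option (Fin d) → 𝔼 d → ℝ
  | none, _ => 1
  | some l, x => max (-R) (min R (x l))

theorem continuous_truncCoord (R : ℝ) (o : Option (Fin d)) : Continuous (truncCoord R o) := by
  cases o with
  | none => exact continuous_const
  | some l =>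
    have : Continuous fun x : 𝔼 d => x l := by fun_prop
    exact continuous_const.max (continuous_const.min this)

theorem abs_truncCoord_le {R : ℝ} (hR : 1 ≤ R) (o : Option (Fin d)) (x : 𝔼 d) :
    |truncCoord R o x| ≤ R := by
  cases o with
  | none => simpa [truncCoord] using hR
  | some l =>
    rw [truncCoord, abs_le]
    exact ⟨le_max_left _ _, max_le (by linarith) (min_le_left _ _)⟩

theorem abs_truncCoord_sub_le (R : ℝ) (o : Option (Fin d)) (x y : 𝔼 d) :
    |truncCoord R o x - truncCoord R o y| ≤ 1 * ‖x - y‖ := by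
  rw [one_mul]
  cases o with
  | none => simp [truncCoord]
  | some l =>
    simp only [truncCoord]
    refine (abs_max_sub_max_le_max _ _ _ _).trans (max_le (by simp) ?_)
    refine (abs_min_sub_min_le_max _ _ _ _).trans (max_le (by simp) ?_)
    simpa using PiLp.norm_apply_le (x - y) l

theorem truncCoord_some {R : ℝ} {x : 𝔼 d} (hx : ‖x‖ ≤ R) (l : Fin d) :
    truncCoord R (some l) x = x l := by
  have h : |x l| ≤ R := by
    simpa using (PiLp.norm_apply_le x l).trans hx
  have := abs_le.1 h
  rw [truncCoord, min_eq_right this.2, max_eq_right this.1]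

/-- The constant function forces `a = b`, after which the common nonzero factor cancels from the
coordinates. -/
theorem eq_of_forall_mul_truncCoord {R a b : ℝ} {x y : 𝔼 d} (hx : ‖x‖ ≤ R) (hy : ‖y‖ ≤ R)
    (ha : a ≠ 0) (h : ∀ o, a * truncCoord R o x = b * truncCoord R o y) : x = y := by
  have hab : a = b := by simpa [truncCoord] using h none
  ext l
  have := h (some l)
  rw [truncCoord_some hx, truncCoord_some hy, ← hab] at this
  exact mul_left_cancel₀ ha this

namespace IsLevyProfile

theorem normOne_truncCoord_mul_lt_top (hj : IsLevyProfile d j) {R : ℝ} (hR : 1 ≤ R)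
    (o : Option (Fin d)) {u : 𝔼 d → ℝ} (hu : Measurable u)
    (hfin : normOne volume (jumpMeasure d j) u < ∞) :
    normOne volume (jumpMeasure d j) (fun x => truncCoord R o x * u x) < ∞ := by
  have hE : sqInt (jumpMeasure d j) (diff u) < ∞ := lt_of_le_of_lt le_self_add hfin
  have h2 : sqInt volume u < ∞ := lt_of_le_of_lt le_add_self hfin
  refine ENNReal.add_lt_top.2 ⟨hj.sqInt_diff_mul_lt_top (C := 4 * R ^ 2 + 1 ^ 2) (by positivity)
    hu h2 hE (continuous_truncCoord R o).measurable (sq_sub_le_of_bounded_lipschitz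
      (abs_truncCoord_le hR o) (abs_truncCoord_sub_le R o)) (abs_truncCoord_le hR o), ?_⟩
  have hle : sqInt volume (fun x => truncCoord R o x * u x) ≤ sqInt volume fun x => R * u x := by
    refine sqInt_mono_abs (ae_of_all _ fun x => ?_)
    rw [abs_mul, abs_mul, abs_of_nonneg (by linarith : (0 : ℝ) ≤ R)]
    gcongr
    exact abs_truncCoord_le hR o x
  have hfin' : normOne volume (jumpMeasure d j) (fun x => R * u x) < ∞ := by
    rw [normOne_const_mul]
    exact ENNReal.mul_lt_top ENNReal.ofReal_lt_top hfin
  exact hle.trans_lt (lt_of_le_of_lt le_add_self hfin')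

/-- A function of finite norm together with a version that is continuous on the members of a
nest. -/
theorem isQuasiContinuousVersion_toLp {m : Measure 𝔼 d} {ν : Measure (𝔼 d × 𝔼 d)} {g f : 𝔼 d → ℝ}
    (hg : MemLp g 2 m) (hgf : g =ᵐ[m] f) {A : ℕ → Set 𝔼 d}
    (hA : IsNest (jumpDomain m ν) (jumpForm m ν) A) (hf : ∀ k, ContinuousOn f (A k)) :
    IsQuasiContinuousVersion (jumpDomain m ν) (jumpForm m ν) (hg.toLp g) f :=
  ⟨hg.coeFn_toLp.trans hgf, A, hA, hf⟩

open scoped Classical in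
theorem ae_eq_piecewise (hfr : volume (frontier D) = 0) {w f h : 𝔼 d → ℝ}
    (hw : ∀ x ∉ D, w x = 0) (hfw : f =ᵐ[volume] w) (hh : ∀ x ∈ closure D, h x = 0) :
    (fun x => w x + h x) =ᵐ[refMeasure j D] (closure D).piecewise f h := by
  filter_upwards [(refMeasure_absolutelyContinuous j D).ae_le hfw, ae_notMem_frontier hfr]
    with x h1 h2
  by_cases hx : x ∈ closure D
  · rw [Set.piecewise_eq_of_mem _ _ _ hx, hh x hx, h1, add_zero]
  · rw [Set.piecewise_eq_of_notMem _ _ _ hx, hw x fun h => hx (subset_closure h), zero_add]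

open scoped Classical in
-- The inner part `1_D u` already has a quasi-continuous version and is kept; only the exterior part
-- is replaced, by a continuous function vanishing on `closure D`.
theorem exists_dense_quasiContinuous (hj : IsLevyProfile d j) (hD : IsOpen D) (hne : D.Nonempty)
    (hb : Bornology.IsBounded D) (hfr : volume (frontier D) = 0) :
    ∃ S : Set (Lp ℝ 2 (refMeasure j D)),
      IsFormDense (jumpDomain (refMeasure j D) (innerJumpMeasure j D))
        (jumpForm (refMeasure j D) (innerJumpMeasure j D)) S ∧
      ∀ u ∈ S, ∃ f : 𝔼 d → ℝ, IsQuasiContinuousVersion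
        (jumpDomain (refMeasure j D) (innerJumpMeasure j D))
        (jumpForm (refMeasure j D) (innerJumpMeasure j D)) u f := by
  have hc := hj.compat hD hne
  have hDm := hD.measurableSet
  refine ⟨{u | u ∈ jumpDomain (refMeasure j D) (innerJumpMeasure j D) ∧
    ∃ f : 𝔼 d → ℝ, IsQuasiContinuousVersion _ _ u f}, hc.isFormDense (fun u hu => hu.1)
      fun u hu hfin ε hε => ?_, fun u hu => hu.2⟩
  have hwm := hu.indicator hDm
  have hw0 : ∀ x ∉ D, D.indicator u x = 0 := fun x hx => Set.indicator_of_notMem hx u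
  obtain ⟨B, f, e, hB, hf, hfw⟩ := hj.exists_cutoffNest (w := fun _ => D.indicator u)
    (fun _ => hwm) fun _ => hj.normOne_indicator_lt_top hD hne hu hfin
  obtain ⟨h, hhc, hh0, hh⟩ := hj.exists_continuous_outer hD hne hb hfr hu hfin
    (lt_min hε one_pos)
  have hgm : Measurable fun x => D.indicator u x + h x := hwm.add hhc.measurable
  have hsub : normOne (refMeasure j D) (innerJumpMeasure j D)
      (fun x => u x - (D.indicator u x + h x)) < min ε 1 := by
    convert! hh using 2
    funext x
    by_cases hx : x ∈ D <;> simp [hx]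
  have hgfin := hc.normOne_lt_top_of_sub hu.aestronglyMeasurable hfin
    (hsub.trans (lt_of_le_of_lt (min_le_right _ _) ENNReal.one_lt_top))
  have hgL := memLp_of_normOne_lt_top hgm.aestronglyMeasurable hgfin
  refine ⟨_, hsub.trans_le (min_le_left _ _), hgL.toLp _,
    ⟨hc.toLp_mem_jumpDomain hgL hgfin, _, isQuasiContinuousVersion_toLp hgL
      (ae_eq_piecewise hfr hw0 (hfw 0) hh0)
      (hj.isNest_glue hD hne hfr (hB.isInnerNest D))
      fun k => continuousOn_piecewise_glue hB.isClosed (hf 0 k) hhc.continuousOn⟩, hgL.coeFn_toLp⟩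

theorem normOne_lt_top_of_continuous_outer (hj : IsLevyProfile d j) (hD : IsOpen D)
    (hb : Bornology.IsBounded D) {h : 𝔼 d → ℝ} (hh : Continuous h) {k : ℕ}
    (h0 : ∀ x ∉ outerSet D k, h x = 0) :
    normOne (refMeasure j D) (innerJumpMeasure j D) h < ∞ := by
  have hDm := hD.measurableSet
  have hm := (isClosed_outerSet D k).measurableSet
  refine (hj.normOne_le_of_zero_on hDm hh.measurable fun x hx => h0 x fun hxk =>
    notMem_closure_of_mem_outerSet hxk (subset_closure hx)).trans_lt
    (ENNReal.mul_lt_top (by simp) ?_)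
  obtain ⟨M, hM⟩ := (isCompact_outerSet D k).exists_bound_of_continuousOn hh.continuousOn
  have hle : sqInt (refMeasure j D) h ≤
      ∫⁻ _ in outerSet D k, ENNReal.ofReal (M ^ 2) ∂(refMeasure j D) := by
    rw [← lintegral_indicator hm]
    refine lintegral_mono fun x => ?_
    by_cases hx : x ∈ outerSet D k
    · rw [Set.indicator_of_mem hx]
      refine ENNReal.ofReal_le_ofReal ?_
      have := abs_le.1 (hM x hx)
      exact sq_le_sq' this.1 this.2
    · simp [h0 x hx]
  refine hle.trans_lt ?_
  rw [setLIntegral_const]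
  exact ENNReal.mul_lt_top ENNReal.ofReal_lt_top (hj.refMeasure_outerSet_lt_top hDm hb k)

open scoped Classical in
theorem exists_separating (hj : IsLevyProfile d j) (hD : IsOpen D) (hne : D.Nonempty)
    (hb : Bornology.IsBounded D) (hfr : volume (frontier D) = 0) :
    ∃ (u : ℕ → Lp ℝ 2 (refMeasure j D)) (f : ℕ → 𝔼 d → ℝ) (N : Set 𝔼 d),
      (∀ n, u n ∈ jumpDomain (refMeasure j D) (innerJumpMeasure j D) ∧
        IsQuasiContinuousVersion (jumpDomain (refMeasure j D) (innerJumpMeasure j D))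
          (jumpForm (refMeasure j D) (innerJumpMeasure j D)) (u n) (f n)) ∧
      IsPolar (jumpDomain (refMeasure j D) (innerJumpMeasure j D))
        (jumpForm (refMeasure j D) (innerJumpMeasure j D)) N ∧
      ∀ x ∉ N, ∀ y ∉ N, x ≠ y → ∃ n, f n x ≠ f n y := by
  have hc := hj.compat hD hne
  have hDm := hD.measurableSet
  have hσ := hj.sigmaFinite_refMeasure hD hne hb hfr
  have hS : SFinite (innerJumpMeasure j D) := by
    unfold innerJumpMeasure jumpMeasure kernelDensity
    infer_instance
  -- The family is dense among the functions vanishing off `D` and itself consists of such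
  -- functions.
  obtain ⟨w, hw, hdense⟩ := hc.exists_countable_dense
    (P := fun u => (Measurable u ∧ ∀ x ∉ D, u x = 0) ∧
      normOne (refMeasure j D) (innerJumpMeasure j D) u < ∞)
    ⟨fun _ => 0, ⟨measurable_const, fun _ _ => rfl⟩, by simp [normOne, sqInt, diff]⟩
    fun u hu => ⟨hu.1.1, hu.2⟩
  have hwm : ∀ i, Measurable (w i) := fun i => (hw i).1.1
  have hw0 : ∀ i, ∀ x ∉ D, w i x = 0 := fun i => (hw i).1.2
  have hwfin : ∀ i, normOne volume (jumpMeasure d j) (w i) < ∞ := fun i => by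
    rw [← hj.normOne_eq_of_zero_off hDm (hwm i) (hw0 i)]
    exact (hw i).2
  obtain ⟨B, f, e, hB, hf, hfw⟩ := hj.exists_cutoffNest hwm hwfin
  have hB' : IsInnerNest j D (nonvanishing B f) := by
    refine hB.isInnerNest_nonvanishing hwm hw0 hwfin hf hfw fun u hu h0 hfin ε hε => ?_
    obtain ⟨i, hi⟩ := hdense u
      ⟨⟨hu, h0⟩, by rwa [hj.normOne_eq_of_zero_off hDm hu h0]⟩ ε hε
    have hm : Measurable fun x => u x - w i x := hu.sub (hwm i)
    refine ⟨i, ?_⟩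
    rwa [← hj.normOne_eq_of_zero_off hDm hm fun x hx => by simp [h0 x hx, hw0 i x hx]]
  have hnest := hj.isNest_glue hD hne hfr hB'
  have hf' : ∀ i k, ContinuousOn (f i) (nonvanishing B f k) := fun i k =>
    (hf i k).mono fun x hx => (mem_nonvanishing.1 hx).1
  obtain ⟨R, hR1, hR⟩ : ∃ R : ℝ, 1 ≤ R ∧ ∀ x ∈ closure D, ‖x‖ ≤ R := by
    obtain ⟨R, hR⟩ := hb.closure.exists_norm_le
    exact ⟨max 1 R, le_max_left _ _, fun x hx => (hR x hx).trans (le_max_right _ _)⟩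
  choose χ hχc hχ1 hχ0 hχb using fun k => exists_cutoff D k
  -- The inner and the outer functions, and their versions.
  let g : (ℕ × Option (Fin d)) ⊕ (ℕ × Option (Fin d)) → 𝔼 d → ℝ := Sum.elim
    (fun q x => truncCoord R q.2 x * w q.1 x)
    (fun q x => χ q.1 x * truncCoord (q.1 + 1) q.2 x)
  let F : (ℕ × Option (Fin d)) ⊕ (ℕ × Option (Fin d)) → 𝔼 d → ℝ := Sum.elim
    (fun q => (closure D).piecewise (fun x => truncCoord R q.2 x * f q.1 x) fun _ => 0)
    (fun q x => χ q.1 x * truncCoord (q.1 + 1) q.2 x)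
  have hFc : ∀ q k, ContinuousOn (F q) (glue D (nonvanishing B f) k) := by
    rintro (q | q) k
    · exact continuousOn_piecewise_glue hB'.isClosed
        ((continuous_truncCoord R q.2).continuousOn.mul (hf' q.1 k)) continuousOn_const
    · exact ((hχc q.1).mul (continuous_truncCoord _ q.2)).continuousOn
  have hgm : ∀ q, Measurable (g q) := by
    rintro (q | q)
    · exact (continuous_truncCoord R q.2).measurable.mul (hwm q.1)
    · exact ((hχc q.1).mul (continuous_truncCoord _ q.2)).measurable
  have hgfin : ∀ q, normOne (refMeasure j D) (innerJumpMeasure j D) (g q) < ∞ := by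
    rintro (q | q)
    · rw [hj.normOne_eq_of_zero_off hDm (hgm _) fun x hx => by simp [g, hw0 q.1 x hx]]
      exact hj.normOne_truncCoord_mul_lt_top hR1 q.2 (hwm q.1) (hwfin q.1)
    · exact hj.normOne_lt_top_of_continuous_outer hD hb (k := q.1 + 1)
        ((hχc q.1).mul (continuous_truncCoord _ q.2)) fun x hx =>
          mul_eq_zero_of_left (hχ0 q.1 x hx) _
  have hgF : ∀ q, g q =ᵐ[refMeasure j D] F q := by
    rintro (q | q)
    · have h1 : (fun x => truncCoord R q.2 x * f q.1 x) =ᵐ[volume]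
          fun x => truncCoord R q.2 x * w q.1 x := (hfw q.1).mono fun x hx => by simp only [hx]
      have h2 := ae_eq_piecewise (j := j) hfr (fun x hx => by simp [hw0 q.1 x hx]) h1
        (h := fun _ => 0) fun _ _ => rfl
      simp only [add_zero] at h2
      exact h2
    · rfl
  have hgL : ∀ q, MemLp (g q) 2 (refMeasure j D) := fun q =>
    memLp_of_normOne_lt_top (hgm q).aestronglyMeasurable (hgfin q)
  obtain ⟨s, hs⟩ := exists_surjective_nat ((ℕ × Option (Fin d)) ⊕ (ℕ × Option (Fin d)))
  refine ⟨fun n => (hgL (s n)).toLp _, fun n => F (s n),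
    ⋂ k, (glue D (nonvanishing B f) k)ᶜ, fun n => ⟨hc.toLp_mem_jumpDomain _ (hgfin _),
      isQuasiContinuousVersion_toLp _ (hgF _) hnest (hFc _)⟩, ⟨_, hnest, subset_rfl⟩, ?_⟩
  intro x hx y hy hxy
  suffices ∃ q, F q x ≠ F q y by
    obtain ⟨q, hq⟩ := this
    obtain ⟨n, rfl⟩ := hs q
    exact ⟨n, hq⟩
  -- Off the polar set a point of `closure D` has some `f i` nonzero there, while all inner
  -- functions are zero outside `closure D`; this separates the two regions.
  have hmem : ∀ z, z ∉ ⋂ k, (glue D (nonvanishing B f) k)ᶜ →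
      (z ∈ closure D ∧ ∃ i, f i z ≠ 0) ∨ (z ∉ closure D ∧ ∃ k, z ∈ outerSet D k) := by
    intro z hz
    simp only [Set.mem_iInter, Set.mem_compl_iff, not_forall, not_not] at hz
    obtain ⟨k, hk | hk⟩ := hz
    · obtain ⟨-, i, -, hi⟩ := mem_nonvanishing.1 hk.1
      refine Or.inl ⟨hk.2, i, abs_pos.1 (lt_of_lt_of_le (by positivity) hi)⟩
    · exact Or.inr ⟨notMem_closure_of_mem_outerSet hk, k, hk⟩
  have hFin : ∀ i o, ∀ z ∈ closure D, F (Sum.inl (i, o)) z = truncCoord R o z * f i z :=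
    fun i o z hz => by
      simp only [F, Sum.elim_inl]
      exact Set.piecewise_eq_of_mem _ _ _ hz
  have hFout : ∀ i o, ∀ z ∉ closure D, F (Sum.inl (i, o)) z = 0 :=
    fun i o z hz => by
      simp only [F, Sum.elim_inl]
      exact Set.piecewise_eq_of_notMem _ _ _ hz
  rcases hmem x hx with ⟨hxD, i, hi⟩ | ⟨hxD, k, hk⟩ <;>
    rcases hmem y hy with ⟨hyD, i', hi'⟩ | ⟨hyD, k', hk'⟩
  · by_contra! hcon
    refine hxy (eq_of_forall_mul_truncCoord (hR x hxD) (hR y hyD) hi (b := f i y) fun o => ?_)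
    have := hcon (Sum.inl (i, o))
    rwa [hFin i o x hxD, hFin i o y hyD, mul_comm, mul_comm _ (f i y)] at this
  · refine ⟨Sum.inl (i, none), ?_⟩
    rw [hFin i none x hxD, hFout i none y hyD]
    simpa [truncCoord] using hi
  · refine ⟨Sum.inl (i', none), ?_⟩
    rw [hFin i' none y hyD, hFout i' none x hxD]
    simpa [truncCoord] using hi'.symm
  -- For two exterior points a common index makes the cut-off function equal to `1` at both, and the
  -- coordinates there are not truncated.
  · by_contra! hcon
    have hk1 := monotone_outerSet D (le_max_left k k') hk
    have hk2 := monotone_outerSet D (le_max_right k k') hk'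
    have hle : ((max k k' : ℕ) : ℝ) ≤ (max k k' : ℕ) + 1 := by linarith
    refine hxy (eq_of_forall_mul_truncCoord (hk1.2.trans hle) (hk2.2.trans hle) one_ne_zero
      (b := 1) fun o => ?_)
    have := hcon (Sum.inr (max k k', o))
    simpa only [F, Sum.elim_inr, hχ1 _ x hk1, hχ1 _ y hk2] using this

end IsLevyProfile

end NonlocalForm

end

theorem theorem4p3 (d : ℕ) (hd : 2 ≤ d)
    (j : ℝ → ℝ) (hj_pos : ∀ r, 0 < r → 0 < j r) (hj_anti : AntitoneOn j (Set.Ioi 0))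
    (hj_levy : ∫⁻ x : EuclideanSpace ℝ (Fin d),
      ENNReal.ofReal (min 1 (‖x‖ ^ 2) * j ‖x‖) < ∞)
    (D : Set (EuclideanSpace ℝ (Fin d))) (hD_open : IsOpen D) (hD_nonempty : D.Nonempty)
    (hD_bdd : Bornology.IsBounded D) (hD_frontier : volume (frontier D) = 0) :
    DirichletForm.IsQuasiRegularDirichletForm
      (NonlocalForm.formDomain j D) (NonlocalForm.formLp j D) := by
  have hj : NonlocalForm.IsLevyProfile d j := ⟨hd, hj_pos, hj_anti, hj_levy⟩
  rw [hj.formDomain_eq hD_open.measurableSet, hj.formLp_eq hD_open.measurableSet]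
  -- Any cut-off nest serves here, so the zero family is enough; compactness comes from gluing,
  -- since `closure D` is compact.
  obtain ⟨B, _, e, hB, -, -⟩ := hj.exists_cutoffNest (w := fun _ _ => 0)
    (fun _ => measurable_const) fun _ => by simp [JumpForm.normOne, JumpForm.sqInt, JumpForm.diff]
  exact
    { sigmaFinite := hj.sigmaFinite_refMeasure hD_open hD_nonempty hD_bdd hD_frontier
      fullSupport := hj.isOpenPosMeasure_refMeasure hD_open hD_nonempty
      isDirichletForm := (hj.compat hD_open hD_nonempty).isDirichletForm
        (hj.dense_jumpDomain hD_open hD_nonempty hD_bdd)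
      exists_compact_nest := ⟨_, hj.isNest_glue hD_open hD_nonempty hD_frontier
        (hB.isInnerNest D), NonlocalForm.isCompact_glue hD_bdd hB.isClosed⟩
      exists_dense_quasiContinuous :=
        hj.exists_dense_quasiContinuous hD_open hD_nonempty hD_bdd hD_frontier
      exists_separating := hj.exists_separating hD_open hD_nonempty hD_bdd hD_frontier }
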